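/- Let $a,b>0$ be real and let $\Phi_{a,b}(z)={}_1F_1(a;a+b;z)=\sum_{n\ge 0}\frac{(a)_n}{(a+b)_n}\frac{z^n}{n!}$, where $(x)_n=x(x+1)\cdots(x+n-1)$. The function $\Phi_{a,b}$ has infinitely many complex zeros, which can be listed, each repeated according to its multiplicity, as a sequence $(z_{a,b;k})_{k\ge 1}$. Let any such sequence be given, let $\Gamma_1,\Gamma_2,\dots$ be independent random variables on a probability space, each with the exponential density $e^{-x}$ on $[0,\infty)$, and put $$\mathfrak{Z}_{a,b}=-\frac{a}{a+b}+\sum_{k=1}^{\infty}\frac{\Gamma_k-1}{z_{a,b;k}}=-\frac{a}{a+b}+\lim_{N\to\infty}\sum_{k=1}^{N}\frac{\Gamma_k-1}{z_{a,b;k}}.$$ Then the series converges almost surely and $\mathfrak{Z}_{a,b}$ is a complex random variable. For $z\in\mathbb{C}$ the expectation $\mathbb{E}\,e^{z\mathfrak{Z}_{a,b}}$ exists (that is, $e^{z\mathfrak{Z}_{a,b}}$ is integrable) if and only if $\operatorname{Re}(z/z_{a,b;k})<1$ for all $k$ (in particular it exists for $|z|<\min_k|z_{a,b;k}|$), and for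 all these $z$ $$\mathbb{E}\,e^{z\mathfrak{Z}_{a,b}}=\frac{1}{\Phi_{a,b}(z)}.$$ Moreover, if $\mathfrak{B}_{a,b}$ is a random variable on the same space, independent of $\mathfrak{Z}_{a,b}$ and with the beta density $\frac{\Gamma(a+b)}{\Gamma(a)\Gamma(b)}x^{a-1}(1-x)^{b-1}$ on $(0,1)$, then $\mathfrak{B}_{a,b}$ and $\mathfrak{Z}_{a,b}$ are conjugate: they are independent and, for every integer $n\ge 0$, the expectation $\mathbb{E}\left[(\mathfrak{B}_{a,b}+\mathfrak{Z}_{a,b})^n\right]$ exists and equals $1$ if $n=0$ and $0$ if $n\ge 1$. -/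

import Mathlib

open MeasureTheory ProbabilityTheory Filter Topology

noncomputable section

/-- The Kummer function `M(a, c; z) = ∑ₙ (a)ₙ / (c)ₙ * zⁿ / n!`, where `(a)ₙ` is the rising
factorial. -/
def kummerM (a c : ℝ) (z : ℂ) : ℂ :=
  ∑' n : ℕ, (((ascPochhammer ℝ n).eval a / (ascPochhammer ℝ n).eval c : ℝ) : ℂ) *
    z ^ n / (n.factorial : ℂ)

/-- `Φ_{a,b}(z) = M(a, a + b; z)`. -/
def kummerPhi (a b : ℝ) (z : ℂ) : ℂ := kummerM a (a + b) z

/-- The sequence `ζ` lists the zeros of `f`, each one as often as its multiplicity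
(and hence nothing that is not a zero, as the order of vanishing there is `0`). -/
def IsZeroSequence (f : ℂ → ℂ) (ζ : ℕ → ℂ) : Prop :=
  ∀ w : ℂ, {k : ℕ | ζ k = w}.encard = analyticOrderAt f w

/-- The partial sums `-a/(a+b) + ∑_{k < N} (Γ_k - 1) / ζ_k`. -/
def zPartialSum {Ω : Type*} (a b : ℝ) (ζ : ℕ → ℂ) (Γ : ℕ → Ω → ℝ) (N : ℕ) (ω : Ω) : ℂ :=
  -((a / (a + b) : ℝ) : ℂ) + ∑ k ∈ Finset.range N, ((Γ k ω : ℂ) - 1) / ζ k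

/-- The random variable `-a/(a+b) + ∑_{k ≥ 0} (Γ_k - 1) / ζ_k`, the series being the limit of its
partial sums (an arbitrary constant where there is no limit). -/
def zVariable {Ω : Type*} (a b : ℝ) (ζ : ℕ → ℂ) (Γ : ℕ → Ω → ℝ) (ω : Ω) : ℂ :=
  limUnder atTop (fun N : ℕ => zPartialSum a b ζ Γ N ω)

/-- Conjugate random variables: `X` and `Y` are independent, and `E (X + Y) ^ n` exists and equals
`1` for `n = 0` and `0` for `n ≥ 1`. -/
def AreConjugate {Ω : Type*} [MeasurableSpace Ω] (X Y : Ω → ℂ) (P : Measure Ω) : Prop :=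
  IndepFun X Y P ∧
    ∀ n : ℕ, Integrable (fun ω => (X ω + Y ω) ^ n) P ∧
      ∫ ω, (X ω + Y ω) ^ n ∂P = if n = 0 then 1 else 0

end

/-! For a beta variable B, Φ(z) = E e^{zB}. Hence Φ is entire, |Φ(z)| ≤ e^{|z|}, Φ(0) = 1 and Φ'(0)
= a/(a+b). Hadamard's factorisation (`IsZeroFamily.hasProd`) gives Φ(z) = e^{Φ'(0)z} ∏ (1 - z/ζ_k)
e^{z/ζ_k}. For Re u < 1 a standard exponential Γ has E e^{u(Γ-1)} = 1/((1-u)e^u), so with u = z/ζ_k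
the reciprocal of each factor is the transform of one term of the series, and multiplying them
yields E e^{zZ} = 1/Φ(z).

Everything rests on ∑ |ζ_k|^{-2} < ∞, which follows from counting zeros in discs. It makes the
product converge, it makes the random series converge almost surely
(`ae_exists_tendsto_sum_of_summable_variance`), and it bounds the partial exponentials in some L^p
with p > 1, so that limit and expectation commute (`integrable_cexp_and_tendsto`). If Re(z/ζ_j) ≥ 1,
the j-th factor alone has infinite expectation and independence carries this over to the whole
(`not_integrable_cexp`).

Conjugacy: near 0, E e^{z(B+Z)} = Φ(z)/Φ(z) = 1, and comparing power series gives the moments. There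
are infinitely many zeros because otherwise Φ would be e^{cz} times a polynomial, against its decay
on the imaginary axis (`IsZeroFamily.infinite`). As this argument applies the factorisation to a
finite family, the index type of the zeros is left arbitrary. -/

/-- `ζ` lists the zeros of `f` over an arbitrary index type. -/
def IsZeroFamily {ι : Type*} (f : ℂ → ℂ) (ζ : ι → ℂ) : Prop :=
  ∀ w : ℂ, {k : ι | ζ k = w}.encard = analyticOrderAt f w

/-- The polynomial `∏_{k ∈ S} (1 - z / ζ k)`. -/
noncomputable def zeroProd {ι : Type*} (ζ : ι → ℂ) (S : Finset ι) (z : ℂ) : ℂ := ∏ k ∈ S, (1 - z / ζ k)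

/-! ### Dividing out finitely many zeros, and counting zeros in a disc -/

section Factor

variable {ι : Type*} {f : ℂ → ℂ} {ζ : ι → ℂ}

lemma differentiable_zeroProd (ζ : ι → ℂ) (S : Finset ι) : Differentiable ℂ (zeroProd ζ S) := by
  unfold zeroProd; fun_prop

lemma zeroProd_zero (ζ : ι → ℂ) (S : Finset ι) : zeroProd ζ S 0 = 1 := by simp [zeroProd]

lemma analyticOrderAt_one_sub_div {c : ℂ} (hc : c ≠ 0) (w : ℂ) :
    analyticOrderAt (fun z => 1 - z / c) w = if c = w then 1 else 0 := by
  have hd : Differentiable ℂ (fun z : ℂ => 1 - z / c) := by fun_prop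
  split_ifs with h
  · subst h
    apply AnalyticAt.analyticOrderAt_eq_one_of_zero_deriv_ne_zero (hd.analyticAt _)
    · simp [hc]
    · have : HasDerivAt (fun z : ℂ => 1 - z / c) (-(1 / c)) c :=
        ((hasDerivAt_id c).div_const c).const_sub 1
      rw [this.deriv]
      simpa using hc
  · rw [(hd.analyticAt _).analyticOrderAt_eq_zero]
    intro h0
    field_simp at h0
    exact h (sub_eq_zero.mp (by simpa using h0))

lemma analyticOrderAt_zeroProd (hζ0 : ∀ k, ζ k ≠ 0) (S : Finset ι) (w : ℂ) :
    analyticOrderAt (zeroProd ζ S) w = ((S.filter (fun k => ζ k = w)).card : ℕ∞) := by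
  classical
  induction S using Finset.induction_on with
  | empty =>
    have h : zeroProd ζ (∅ : Finset ι) = fun _ => 1 := by ext; simp [zeroProd]
    rw [h, (analyticAt_const).analyticOrderAt_eq_zero.2 one_ne_zero]
    simp
  | insert k S hk ih =>
    have h : zeroProd ζ (insert k S) = (fun z => 1 - z / ζ k) * zeroProd ζ S := by
      ext z; simp [zeroProd, Finset.prod_insert hk]
    have hd : Differentiable ℂ (fun z : ℂ => 1 - z / ζ k) := by fun_prop
    rw [h, analyticOrderAt_mul (hd.analyticAt _) ((differentiable_zeroProd ζ S).analyticAt _), ih,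
      analyticOrderAt_one_sub_div (hζ0 k), Finset.filter_insert]
    split_ifs with h1
    · rw [Finset.card_insert_of_notMem (by simp [hk])]
      push_cast
      ring
    · simp

lemma IsZeroFamily.card_filter_le (hζ : IsZeroFamily f ζ) (S : Finset ι) (w : ℂ) :
    ((S.filter (fun k => ζ k = w)).card : ℕ∞) ≤ analyticOrderAt f w := by
  rw [← hζ w, ← Set.encard_coe_eq_coe_finsetCard]
  apply Set.encard_le_encard
  intro k hk
  simpa using (Finset.mem_filter.1 (Finset.mem_coe.1 hk)).2

lemma IsZeroFamily.apply_eq_zero (hζ : IsZeroFamily f ζ) (k : ι) : f (ζ k) = 0 := by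
  apply apply_eq_zero_of_analyticOrderAt_ne_zero
  rw [← hζ]
  exact Set.encard_ne_zero.2 ⟨k, rfl⟩

lemma IsZeroFamily.exists_eq_of_apply_eq_zero (hζ : IsZeroFamily f ζ) (hf : Differentiable ℂ f)
    {w : ℂ} (hw : f w = 0) : ∃ k, ζ k = w := by
  have := (hf.analyticAt w).analyticOrderAt_ne_zero.2 hw
  rw [← hζ] at this
  exact Set.encard_ne_zero.1 this

lemma IsZeroFamily.ne_zero (hζ : IsZeroFamily f ζ) (hf0 : f 0 = 1) (k : ι) : ζ k ≠ 0 := by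
  intro h
  have := hζ.apply_eq_zero k
  rw [h, hf0] at this
  exact one_ne_zero this

/-- Zeros are divided out one at a time: the order of `f` at `ζ k` is at least the multiplicity of
`ζ k` within `insert k S`, hence exceeds its multiplicity within `S`, so the previous quotient still
vanishes at `ζ k`. -/
lemma IsZeroFamily.exists_factor (hζ : IsZeroFamily f ζ) (hf : Differentiable ℂ f) (hf0 : f 0 = 1)
    (S : Finset ι) : ∃ g : ℂ → ℂ, Differentiable ℂ g ∧ f = zeroProd ζ S * g := by
  classical
  induction S using Finset.induction_on with
  | empty => exact ⟨f, hf, by ext; simp [zeroProd]⟩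
  | insert k S hk ih =>
    obtain ⟨g, hg, hfg⟩ := ih
    have hk0 := hζ.ne_zero hf0 k
    have h1 := hζ.card_filter_le (insert k S) (ζ k)
    have h2 := analyticOrderAt_mul ((differentiable_zeroProd ζ S).analyticAt (ζ k))
      (hg.analyticAt (ζ k))
    rw [← hfg, analyticOrderAt_zeroProd (hζ.ne_zero hf0)] at h2
    rw [h2, Finset.filter_insert, if_pos rfl, Finset.card_insert_of_notMem (by simp [hk])] at h1
    have h3 : g (ζ k) = 0 := by
      by_contra hne
      rw [(hg.analyticAt (ζ k)).analyticOrderAt_eq_zero.2 hne] at h1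
      simp only [add_zero] at h1
      norm_cast at h1
      omega
    refine ⟨fun z => -ζ k * dslope g (ζ k) z, ?_, ?_⟩
    · apply Differentiable.const_mul
      rw [← differentiableOn_univ, Complex.differentiableOn_dslope Filter.univ_mem]
      exact hg.differentiableOn
    · ext z
      have h4 : (z - ζ k) * dslope g (ζ k) z = g z := by
        have := sub_smul_dslope g (ζ k) z
        rw [h3, sub_zero] at this
        simpa using this
      rw [hfg]
      simp only [Pi.mul_apply, zeroProd, Finset.prod_insert hk]
      rw [← h4]
      field_simp
      ring

lemma IsZeroFamily.factor_ne_zero (hζ : IsZeroFamily f ζ) (hf0 : f 0 = 1)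
    {S : Finset ι} {g : ℂ → ℂ} (hg : Differentiable ℂ g) (hfg : f = zeroProd ζ S * g) {w : ℂ}
    (hw : ∀ k, ζ k = w → k ∈ S) : g w ≠ 0 := by
  classical
  have h2 := analyticOrderAt_mul ((differentiable_zeroProd ζ S).analyticAt w) (hg.analyticAt w)
  have h3 : {k | ζ k = w} = ((S.filter (fun k => ζ k = w) : Finset ι) : Set ι) := by
    ext k
    simpa using hw k
  rw [← hfg, analyticOrderAt_zeroProd (hζ.ne_zero hf0), ← hζ w, h3,
    Set.encard_coe_eq_coe_finsetCard] at h2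
  rw [← (hg.analyticAt w).analyticOrderAt_eq_zero]
  generalize analyticOrderAt g w = x at h2
  -- Cancellation in `ℕ∞` is legitimate because the cardinality is finite.
  have : ((S.filter (fun k => ζ k = w)).card : ℕ∞) + 0 = (S.filter (fun k => ζ k = w)).card + x := by
    rw [add_zero]; exact h2
  exact (WithTop.add_left_cancel (ENat.natCast_ne_top _) this).symm

/-- Maximum principle: on the circle of radius `ρ` every factor `1 - w / ζ k` has modulus at least
`m`. -/
lemma IsZeroFamily.norm_factor_mul_le (hζ : IsZeroFamily f ζ) (hf0 : f 0 = 1)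
    (hfb : ∀ z, ‖f z‖ ≤ Real.exp ‖z‖)
    {S : Finset ι} {g : ℂ → ℂ} (hg : Differentiable ℂ g) (hfg : f = zeroProd ζ S * g)
    {m ρ : ℝ} (hm : 0 < m) (hρ : 0 < ρ) (hS : ∀ k ∈ S, ‖ζ k‖ * (1 + m) ≤ ρ) {z : ℂ}
    (hz : ‖z‖ ≤ ρ) : ‖g z‖ * m ^ S.card ≤ Real.exp ρ := by
  rw [← le_div_iff₀ (by positivity)]
  refine Complex.norm_le_of_forall_mem_frontier_norm_le (U := Metric.ball 0 ρ)
    Metric.isBounded_ball hg.diffContOnCl ?_ ?_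
  · intro w hw
    rw [frontier_ball _ hρ.ne', mem_sphere_zero_iff_norm] at hw
    rw [le_div_iff₀ (by positivity)]
    have h1 : m ^ S.card ≤ ‖zeroProd ζ S w‖ := by
      rw [zeroProd, norm_prod]
      rw [← Finset.prod_const]
      refine Finset.prod_le_prod (fun _ _ => hm.le) ?_
      intro k hk
      have h0 := norm_pos_iff.2 (hζ.ne_zero hf0 k)
      have : 1 + m ≤ ‖w / ζ k‖ := by
        rw [norm_div, le_div_iff₀ h0, hw]
        linarith [hS k hk]
      have h5 := norm_sub_norm_le (w / ζ k) 1
      rw [norm_sub_rev] at h5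
      simp only [norm_one] at h5
      linarith
    have h2 := hfb w
    rw [hfg, Pi.mul_apply, norm_mul, hw] at h2
    nlinarith [norm_nonneg (g w)]
  · rw [closure_ball _ hρ.ne']
    simpa using hz

/-- A substitute for Jensen's formula: as the quotient is 1 at the origin, the circle of radius 3R
gives 2^card ≤ e^{3R}, and 3 / log 2 < 6. -/
lemma IsZeroFamily.card_le_of_norm_le (hζ : IsZeroFamily f ζ) (hf : Differentiable ℂ f) (hf0 : f 0 = 1)
    (hfb : ∀ z, ‖f z‖ ≤ Real.exp ‖z‖) {R : ℝ} (hR : 0 < R) (S : Finset ι)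
    (hS : ∀ k ∈ S, ‖ζ k‖ ≤ R) : (S.card : ℝ) ≤ 6 * R := by
  obtain ⟨g, hg, hfg⟩ := hζ.exists_factor hf hf0 S
  have h := hζ.norm_factor_mul_le hf0 hfb hg hfg (m := 2) (ρ := 3 * R) (by norm_num) (by positivity)
    (fun k hk => by linarith [hS k hk]) (z := 0) (by simp; positivity)
  have hg0 : g 0 = 1 := by
    have := congrFun hfg 0
    simpa [hf0, zeroProd_zero] using this.symm
  rw [hg0, norm_one, one_mul] at h
  have h2 := Real.log_le_log (by positivity) h
  rw [Real.log_exp, Real.log_pow] at h2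
  have := Real.log_two_gt_d9
  have h3 : (0 : ℝ) ≤ S.card := by positivity
  nlinarith

lemma IsZeroFamily.finite_norm_le (hζ : IsZeroFamily f ζ) (hf : Differentiable ℂ f) (hf0 : f 0 = 1)
    (hfb : ∀ z, ‖f z‖ ≤ Real.exp ‖z‖) (R : ℝ) : {k | ‖ζ k‖ ≤ R}.Finite := by
  by_contra h
  have h : {k | ‖ζ k‖ ≤ R}.Infinite := h
  have hM : 0 < max R 1 := by positivity
  obtain ⟨n, hn⟩ := exists_nat_gt (6 * max R 1)
  obtain ⟨S, hS, hc⟩ := h.exists_subset_card_eq n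
  have := hζ.card_le_of_norm_le hf hf0 hfb hM S (fun k hk => (hS hk).trans (le_max_left _ _))
  rw [hc] at this
  linarith

end Factor

/-! ### Hadamard factorisation for exponential type -/

section Hadamard

variable {ι : Type*} {f : ℂ → ℂ} {ζ : ι → ℂ}

lemma summable_inv_norm_sq_of_card_le {C : ℝ} (hC : 0 ≤ C)
    (hcard : ∀ R : ℝ, 0 < R → ∀ S : Finset ι, (∀ k ∈ S, ‖ζ k‖ ≤ R) → (S.card : ℝ) ≤ C * R)
    (hfin : ∀ R : ℝ, {k | ‖ζ k‖ ≤ R}.Finite) : Summable (fun k => (‖ζ k‖ ^ 2)⁻¹) := by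
  classical
  -- Dyadic shells: shell n has at most C·2^(n+1) members, each weighted 4^(-n). Members of norm
  -- below 1 go to shell 0 without a lower bound; they are finitely many and are discarded at the
  -- end.
  have hj : ∀ k, ∃ n : ℕ, ‖ζ k‖ ≤ 2 ^ (n + 1) ∧ (1 ≤ ‖ζ k‖ → (2 : ℝ) ^ n ≤ ‖ζ k‖) := by
    intro k
    by_cases h : 1 ≤ ‖ζ k‖
    · obtain ⟨n, hn1, hn2⟩ := exists_nat_pow_near h (one_lt_two)
      exact ⟨n, hn2.le, fun _ => hn1⟩
    · exact ⟨0, by norm_num; linarith, fun h' => absurd h' h⟩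
  choose j hj1 hj2 using hj
  have hsum : Summable (fun k => ((1 / 4 : ℝ)) ^ j k) := by
    apply summable_of_sum_le (c := 2 * C * 2) (fun k => by positivity)
    intro S
    obtain ⟨M, hM⟩ : ∃ M, ∀ k ∈ S, j k ∈ Finset.range M := by
      refine ⟨S.sup j + 1, fun k hk => ?_⟩
      rw [Finset.mem_range, Nat.lt_succ_iff]
      exact Finset.le_sup hk
    rw [← Finset.sum_fiberwise_of_maps_to hM]
    calc ∑ n ∈ Finset.range M, ∑ k ∈ S with j k = n, (1 / 4 : ℝ) ^ j k
        ≤ ∑ n ∈ Finset.range M, 2 * C * (1 / 2 : ℝ) ^ n := by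
          apply Finset.sum_le_sum
          intro n _
          have h1 : ∑ k ∈ S with j k = n, (1 / 4 : ℝ) ^ j k
              = ((S.filter (fun k => j k = n)).card : ℝ) * (1 / 4) ^ n := by
            rw [Finset.sum_congr rfl (g := fun _ => (1 / 4 : ℝ) ^ n)
              (fun k hk => by rw [(Finset.mem_filter.1 hk).2])]
            simp
          have h2 := hcard (2 ^ (n + 1)) (by positivity) (S.filter (fun k => j k = n))
            (fun k hk => by rw [← (Finset.mem_filter.1 hk).2]; exact hj1 k)
          rw [h1]
          calc _ ≤ C * 2 ^ (n + 1) * (1 / 4 : ℝ) ^ n := by gcongr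
            _ = 2 * C * (1 / 2 : ℝ) ^ n := by
              have : (1 / 4 : ℝ) = (1 / 2) * (1 / 2) := by norm_num
              rw [this, mul_pow, pow_succ]
              have h3 : (2 : ℝ) ^ n * (1 / 2) ^ n = 1 := by rw [← mul_pow]; norm_num
              linear_combination (C * 2 * (1 / 2) ^ n) * h3
      _ = 2 * C * ∑ n ∈ Finset.range M, (1 / 2 : ℝ) ^ n := by rw [Finset.mul_sum]
      _ ≤ 2 * C * 2 := by
          gcongr
          exact sum_geometric_two_le M
  refine hsum.of_norm_bounded_eventually ?_
  refine (hfin 1).subset ?_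
  intro k hk
  simp only [Set.mem_ofPred_eq]
  by_contra h
  push Not at h
  apply hk
  have h1 := hj2 k h.le
  show ‖(‖ζ k‖ ^ 2)⁻¹‖ ≤ (1 / 4) ^ j k
  rw [norm_inv, norm_pow, norm_norm, one_div, inv_pow]
  apply inv_anti₀ (by positivity)
  calc (4 : ℝ) ^ j k = (2 ^ j k) ^ 2 := by rw [← pow_mul, mul_comm, pow_mul]; norm_num
    _ ≤ _ := by gcongr

lemma IsZeroFamily.summable_inv_norm_sq (hζ : IsZeroFamily f ζ) (hf : Differentiable ℂ f)
    (hf0 : f 0 = 1) (hfb : ∀ z, ‖f z‖ ≤ Real.exp ‖z‖) : Summable (fun k => (‖ζ k‖ ^ 2)⁻¹) :=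
  summable_inv_norm_sq_of_card_le (C := 6) (by norm_num)
    (fun _ hR S hS => hζ.card_le_of_norm_le hf hf0 hfb hR S hS) (hζ.finite_norm_le hf hf0 hfb)

/-- The logarithm is the primitive of g'/g vanishing at 0. -/
lemma exists_log_on_ball {g : ℂ → ℂ} (hg : Differentiable ℂ g) (hg0 : g 0 = 1) {R : ℝ} (hR : 0 < R)
    (hne : ∀ z ∈ Metric.ball (0 : ℂ) R, g z ≠ 0) :
    ∃ h : ℂ → ℂ, h 0 = 0 ∧ DifferentiableOn ℂ h (Metric.ball 0 R) ∧ deriv h 0 = deriv g 0 ∧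
      ∀ z ∈ Metric.ball (0 : ℂ) R, g z = Complex.exp (h z) := by
  have hd : DifferentiableOn ℂ (fun z => deriv g z / g z) (Metric.ball 0 R) := by
    apply DifferentiableOn.div _ hg.differentiableOn hne
    exact (hg.differentiableOn.deriv isOpen_univ).mono (Set.subset_univ _)
  obtain ⟨h, h0, hh⟩ := hd.isExactOn_ball.with_val_at 0 0
  have h0mem : (0 : ℂ) ∈ Metric.ball (0 : ℂ) R := Metric.mem_ball_self hR
  refine ⟨h, h0, fun z hz => (hh z hz).differentiableAt.differentiableWithinAt, ?_, ?_⟩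
  · rw [(hh 0 h0mem).deriv, hg0, div_one]
  · have hder : ∀ z ∈ Metric.ball (0 : ℂ) R,
        HasDerivAt (fun z => g z * Complex.exp (-h z)) 0 z := by
      intro z hz
      have h1 := (hg z).hasDerivAt.mul (hh z hz).neg.cexp
      refine h1.congr_deriv ?_
      have := hne z hz
      field_simp
      ring
    intro z hz
    have hc := Metric.isOpen_ball.is_const_of_deriv_eq_zero
      (convex_ball (0 : ℂ) R).isPreconnected
      (fun z hz => (hder z hz).differentiableAt.differentiableWithinAt)
      (fun z hz => (hder z hz).deriv) hz h0mem
    simp only [h0, hg0, neg_zero, Complex.exp_zero, mul_one, Complex.exp_neg] at hc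
    have := Complex.exp_ne_zero (h z)
    field_simp at hc
    exact hc

/-- Borel–Carathéodory gives |h| ≤ 4R on the half disc. Dividing by z twice, with the Schwarz lemma
each time, gives first 4R/(R/2) = 8, then 16/(R/2) = 32/R. -/
lemma norm_sub_deriv_mul_le {h : ℂ → ℂ} {R : ℝ} (hR : 0 < R) (h0 : h 0 = 0)
    (hd : DifferentiableOn ℂ h (Metric.ball 0 R)) (hre : ∀ z ∈ Metric.ball 0 R, (h z).re ≤ 2 * R)
    {z : ℂ} (hz : ‖z‖ < R / 2) : ‖h z - deriv h 0 * z‖ ≤ 32 * ‖z‖ ^ 2 / R := by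
  have hR2 : 0 < R / 2 := by positivity
  have hsub : Metric.ball (0 : ℂ) (R / 2) ⊆ Metric.ball 0 R := Metric.ball_subset_ball (by linarith)
  have hnhds : Metric.ball (0 : ℂ) (R / 2) ∈ 𝓝 0 := Metric.ball_mem_nhds _ hR2
  have hb : Set.MapsTo h (Metric.ball 0 (R / 2)) (Metric.closedBall (h 0) (4 * R)) := by
    intro w hw
    have h1 := Complex.borelCaratheodory_zero (M := 2 * R) (by positivity) hd hre hR (hsub hw) h0
    rw [mem_ball_zero_iff] at hw
    rw [h0, mem_closedBall_zero_iff]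
    refine h1.trans ?_
    rw [div_le_iff₀ (by linarith)]
    nlinarith
  have hd2 := hd.mono hsub
  have hdd := (Complex.differentiableOn_dslope hnhds).2 hd2
  have hb1 : ∀ w ∈ Metric.ball (0 : ℂ) (R / 2), ‖dslope h 0 w‖ ≤ 8 := by
    intro w hw
    refine (Complex.norm_dslope_le_div_of_mapsTo_ball hd2 hb hw).trans_eq ?_
    field_simp
    norm_num
  have hzm : z ∈ Metric.ball (0 : ℂ) (R / 2) := by simpa using hz
  have hb2 : ‖dslope (dslope h 0) 0 z‖ ≤ 16 / (R / 2) := by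
    refine Complex.norm_dslope_le_div_of_mapsTo_ball hdd ?_ hzm
    intro w hw
    rw [mem_closedBall_iff_norm]
    have := norm_sub_le (dslope h 0 w) (dslope h 0 0)
    linarith [hb1 w hw, hb1 0 (Metric.mem_ball_self hR2)]
  have e1 := sub_smul_dslope h 0 z
  have e2 := sub_smul_dslope (dslope h 0) 0 z
  simp only [sub_zero, h0, smul_eq_mul, dslope_same] at e1 e2
  have e3 : h z - deriv h 0 * z = z ^ 2 * dslope (dslope h 0) 0 z := by
    rw [← e1]
    linear_combination (-z) * e2
  rw [e3, norm_mul, norm_pow]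
  calc _ ≤ ‖z‖ ^ 2 * (16 / (R / 2)) := by gcongr
    _ = _ := by field_simp; ring

lemma hasDerivAt_zeroProd_zero (ζ : ι → ℂ) (S : Finset ι) :
    HasDerivAt (zeroProd ζ S) (-∑ k ∈ S, 1 / ζ k) 0 := by
  classical
  have h := HasDerivAt.fun_finsetProd (u := S) (f := fun k (z : ℂ) => 1 - z / ζ k)
    (f' := fun k => -(1 / ζ k)) (x := 0)
    (fun k _ => ((hasDerivAt_id (0 : ℂ)).div_const (ζ k)).const_sub 1)
  exact h.congr_deriv (by simp)

/-- The quotient by all zeros of norm at most R is e^h with Re h ≤ 2R. The factors e^{z/ζ} and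
e^{-f'(0)z} together remove exactly the linear term of h, so the error is O(|z|²/R). -/
lemma IsZeroFamily.hadamard_approx (hζ : IsZeroFamily f ζ) (hf : Differentiable ℂ f)
    (hf0 : f 0 = 1) (hfb : ∀ z, ‖f z‖ ≤ Real.exp ‖z‖) {R : ℝ} (hR : 0 < R) {S : Finset ι}
    (hS : ∀ k, k ∈ S ↔ ‖ζ k‖ ≤ R) {z : ℂ} (hz : ‖z‖ < R / 2) :
    ∃ e : ℂ, ‖e‖ ≤ 32 * ‖z‖ ^ 2 / R ∧ f z * Complex.exp (-(deriv f 0 * z)) =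
      (∏ k ∈ S, (1 - z / ζ k) * Complex.exp (z / ζ k)) * Complex.exp e := by
  obtain ⟨g, hg, hfg⟩ := hζ.exists_factor hf hf0 S
  have hg0 : g 0 = 1 := by
    have := congrFun hfg 0
    simpa [hf0, zeroProd_zero] using this.symm
  have hne : ∀ w ∈ Metric.ball (0 : ℂ) R, g w ≠ 0 := by
    intro w hw
    refine hζ.factor_ne_zero hf0 hg hfg ?_
    rintro k rfl
    rw [hS]
    exact (mem_ball_zero_iff.1 hw).le
  obtain ⟨h, h0, hd, hder, hexp⟩ := exists_log_on_ball hg hg0 hR hne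
  have hre : ∀ w ∈ Metric.ball (0 : ℂ) R, (h w).re ≤ 2 * R := by
    intro w hw
    have h1 := hζ.norm_factor_mul_le hf0 hfb hg hfg (m := 1) (ρ := 2 * R) one_pos (by positivity)
      (fun k hk => by linarith [(hS k).1 hk]) (z := w) (by
        have := mem_ball_zero_iff.1 hw
        linarith)
    rw [hexp w hw, Complex.norm_exp, one_pow, mul_one] at h1
    exact Real.exp_le_exp.1 h1
  refine ⟨h z - deriv h 0 * z, norm_sub_deriv_mul_le hR h0 hd hre hz, ?_⟩
  have hdf : deriv f 0 = -∑ k ∈ S, 1 / ζ k + deriv g 0 := by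
    have := (hasDerivAt_zeroProd_zero ζ S).mul (hg 0).hasDerivAt
    rw [← hfg] at this
    rw [this.deriv, hg0, zeroProd_zero]
    ring
  have hzR : z ∈ Metric.ball (0 : ℂ) R := by
    rw [mem_ball_zero_iff]; linarith
  have hs : ∑ k ∈ S, z / ζ k = (∑ k ∈ S, 1 / ζ k) * z := by
    rw [Finset.sum_mul]
    exact Finset.sum_congr rfl fun k _ => by ring
  rw [Finset.prod_mul_distrib, ← Complex.exp_sum, mul_assoc, ← Complex.exp_add, hdf, hder, hfg,
    Pi.mul_apply, hexp z hzR, mul_assoc, ← Complex.exp_add, zeroProd, hs]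
  congr 2
  ring

lemma norm_one_sub_mul_exp_sub_one_le {u : ℂ} (hu : ‖u‖ ≤ 1) :
    ‖(1 - u) * Complex.exp u - 1‖ ≤ 3 * ‖u‖ ^ 2 := by
  have h : (1 - u) * Complex.exp u - 1 = (Complex.exp u - 1 - u) - u * (Complex.exp u - 1) := by
    ring
  rw [h]
  refine (norm_sub_le _ _).trans ?_
  rw [norm_mul]
  have h1 := Complex.norm_exp_sub_one_sub_id_le hu
  have h2 := Complex.norm_exp_sub_one_le hu
  nlinarith [norm_nonneg u]

lemma multipliable_one_sub_mul_exp (hsum : Summable (fun k => (‖ζ k‖ ^ 2)⁻¹)) (z : ℂ) :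
    Multipliable (fun k => (1 - z / ζ k) * Complex.exp (z / ζ k)) := by
  have h1 : Summable (fun k => 3 * ‖z / ζ k‖ ^ 2) := by
    apply Summable.mul_left
    convert hsum.mul_left (‖z‖ ^ 2) using 2 with k
    rw [norm_div, div_pow, div_eq_mul_inv]
  have h2 : ∀ᶠ k in cofinite, ‖z / ζ k‖ ≤ 1 := by
    have h3 := (hsum.mul_left (‖z‖ ^ 2)).tendsto_cofinite_zero
    filter_upwards [h3.eventually (gt_mem_nhds one_pos)] with k hk
    rw [← div_eq_mul_inv, ← div_pow, ← norm_div] at hk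
    exact (pow_le_one_iff_of_nonneg (norm_nonneg _) two_ne_zero).1 hk.le
  have h4 : Summable (fun k => ‖(1 - z / ζ k) * Complex.exp (z / ζ k) - 1‖) := by
    refine h1.of_norm_bounded_eventually ?_
    filter_upwards [h2] with k hk
    rw [norm_norm]
    exact norm_one_sub_mul_exp_sub_one_le hk
  have := _root_.multipliable_one_add_of_summable h4
  simpa using this

/-- The Hadamard factorisation of an entire function of exponential type. -/
theorem IsZeroFamily.hasProd (hζ : IsZeroFamily f ζ) (hf : Differentiable ℂ f)
    (hf0 : f 0 = 1) (hfb : ∀ z, ‖f z‖ ≤ Real.exp ‖z‖) (z : ℂ) :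
    HasProd (fun k => (1 - z / ζ k) * Complex.exp (z / ζ k))
      (f z * Complex.exp (-(deriv f 0 * z))) := by
  have hm := (multipliable_one_sub_mul_exp (hζ.summable_inv_norm_sq hf hf0 hfb) z).hasProd
  suffices h : f z * Complex.exp (-(deriv f 0 * z)) =
      ∏' k, (1 - z / ζ k) * Complex.exp (z / ζ k) by rw [h]; exact hm
  have hfin := hζ.finite_norm_le hf hf0 hfb
  -- The product converges unconditionally, so its value may be computed along the exhaustion by
  -- discs.
  let S : ℕ → Finset ι := fun n => (hfin n).toFinset
  have hS : ∀ n k, k ∈ S n ↔ ‖ζ k‖ ≤ n := fun n k => by simp [S]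
  have hStop : Tendsto S atTop atTop := by
    apply tendsto_atTop_finset_of_monotone
    · intro m n hmn k hk
      rw [hS] at hk ⊢
      exact hk.trans (by exact_mod_cast hmn)
    · intro k
      obtain ⟨n, hn⟩ := exists_nat_ge ‖ζ k‖
      exact ⟨n, (hS n k).2 hn⟩
  have hP := hm.comp hStop
  have hex : ∀ n : ℕ, ∃ e : ℂ, 2 * ‖z‖ < n → ‖e‖ ≤ 32 * ‖z‖ ^ 2 / n ∧
      f z * Complex.exp (-(deriv f 0 * z)) =
      (∏ k ∈ S n, (1 - z / ζ k) * Complex.exp (z / ζ k)) * Complex.exp e := by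
    intro n
    by_cases hn : 2 * ‖z‖ < n
    · obtain ⟨e, he⟩ := hζ.hadamard_approx hf hf0 hfb
        (R := n) (by linarith [norm_nonneg z]) (hS n) (z := z) (by linarith)
      exact ⟨e, fun _ => he⟩
    · exact ⟨0, fun h => absurd h hn⟩
  choose e he using hex
  have hev : ∀ᶠ n : ℕ in atTop, 2 * ‖z‖ < n :=
    tendsto_natCast_atTop_atTop.eventually_gt_atTop _
  have he0 : Tendsto e atTop (𝓝 0) := by
    apply squeeze_zero_norm' (a := fun n : ℕ => 32 * ‖z‖ ^ 2 / n)
    · filter_upwards [hev] with n hn using (he n hn).1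
    · exact tendsto_const_div_atTop_nhds_zero_nat _
  have hlim := hP.mul ((Complex.continuous_exp.tendsto 0).comp he0)
  rw [Complex.exp_zero, mul_one] at hlim
  refine tendsto_nhds_unique (tendsto_const_nhds.congr' ?_) hlim
  filter_upwards [hev] with n hn
  exact (he n hn).2

end Hadamard

/-! ### Transform and moments of the centred exponential law -/

section ExpMeasure

open scoped ENNReal

lemma expMeasure_one_eq : expMeasure 1 =
    (volume.restrict (Set.Ici 0)).withDensity (fun x => ENNReal.ofReal (Real.exp (-x))) := by
  rw [← withDensity_indicator measurableSet_Ici]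
  change volume.withDensity (exponentialPDF 1) = _
  congr 1
  ext x
  rw [exponentialPDF_eq, Set.indicator_apply]
  simp only [Set.mem_Ici, one_mul]
  split_ifs <;> simp

lemma integral_expMeasure_one (g : ℝ → ℂ) :
    ∫ x, g x ∂(expMeasure 1) = ∫ x in Set.Ioi (0 : ℝ), (Real.exp (-x) : ℂ) * g x := by
  rw [expMeasure_one_eq, integral_withDensity_eq_integral_toReal_smul (by fun_prop)
    (ae_of_all _ fun _ => ENNReal.ofReal_lt_top), integral_Ici_eq_integral_Ioi]
  congr with x
  rw [ENNReal.toReal_ofReal (Real.exp_nonneg _), Complex.real_smul]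

lemma integrable_expMeasure_one_iff (g : ℝ → ℂ) :
    Integrable g (expMeasure 1) ↔
      IntegrableOn (fun x => (Real.exp (-x) : ℂ) * g x) (Set.Ioi (0 : ℝ)) := by
  rw [expMeasure_one_eq, integrable_withDensity_iff_integrable_smul' (by fun_prop)
    (ae_of_all _ fun _ => ENNReal.ofReal_lt_top), ← integrableOn_Ici_iff_integrableOn_Ioi,
    IntegrableOn]
  congr! 2 with x
  rw [ENNReal.toReal_ofReal (Real.exp_nonneg _), Complex.real_smul]

lemma ofReal_exp_neg_mul_cexp (u : ℂ) (x : ℝ) :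
    (Real.exp (-x) : ℂ) * Complex.exp (u * ((x : ℂ) - 1)) =
      Complex.exp (-u) * Complex.exp ((u - 1) * x) := by
  rw [Complex.ofReal_exp, ← Complex.exp_add, ← Complex.exp_add]
  congr 1
  push_cast
  ring

lemma integrable_cexp_expMeasure_one {u : ℂ} (hu : u.re < 1) :
    Integrable (fun x : ℝ => Complex.exp (u * ((x : ℂ) - 1))) (expMeasure 1) := by
  rw [integrable_expMeasure_one_iff]
  simp_rw [ofReal_exp_neg_mul_cexp]
  exact (integrableOn_exp_mul_complex_Ioi (by simpa using hu) 0).const_mul _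

lemma integral_cexp_expMeasure_one {u : ℂ} (hu : u.re < 1) :
    ∫ x : ℝ, Complex.exp (u * ((x : ℂ) - 1)) ∂(expMeasure 1) = ((1 - u) * Complex.exp u)⁻¹ := by
  rw [integral_expMeasure_one]
  simp_rw [ofReal_exp_neg_mul_cexp]
  rw [integral_const_mul, integral_exp_mul_complex_Ioi (by simpa using hu), Complex.exp_neg]
  have h1 : 1 - u ≠ 0 := fun h => by
    have : u = 1 := (sub_eq_zero.1 h).symm
    simp [this] at hu
  have h2 : u - 1 ≠ 0 := fun h => h1 (by linear_combination -h)
  have := Complex.exp_ne_zero u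
  simp only [Complex.ofReal_zero, mul_zero, Complex.exp_zero]
  field_simp
  ring

lemma integrable_exp_expMeasure_one {t : ℝ} (ht : t < 1) :
    Integrable (fun x : ℝ => Real.exp (t * (x - 1))) (expMeasure 1) := by
  have := (integrable_cexp_expMeasure_one (u := t) (by simpa using ht)).re
  refine this.congr (ae_of_all _ fun x => ?_)
  simp only [RCLike.re_to_complex]
  rw [← Complex.ofReal_one, ← Complex.ofReal_sub, ← Complex.ofReal_mul, ← Complex.ofReal_exp,
    Complex.ofReal_re]

lemma integral_exp_expMeasure_one {t : ℝ} (ht : t < 1) :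
    ∫ x : ℝ, Real.exp (t * (x - 1)) ∂(expMeasure 1) = ((1 - t) * Real.exp t)⁻¹ := by
  have := integral_cexp_expMeasure_one (u := t) (by simpa using ht)
  have h2 : ∀ x : ℝ, Complex.exp (t * ((x : ℂ) - 1)) = ((Real.exp (t * (x - 1)) : ℝ) : ℂ) := by
    intro x
    push_cast
    rfl
  simp_rw [h2] at this
  rw [integral_complex_ofReal] at this
  exact_mod_cast this

/-- From 1/(1-t) ≤ e^{t/(1-t)}. The exponent is quadratic in t, so such bounds multiply to a finite
constant along a square summable sequence. -/
lemma lintegral_exp_expMeasure_one_le {t q : ℝ} (htq : t ≤ q) (hq : q < 1) :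
    ∫⁻ x : ℝ, ENNReal.ofReal (Real.exp (t * (x - 1))) ∂(expMeasure 1) ≤
      ENNReal.ofReal (Real.exp (t ^ 2 / (1 - q))) := by
  have ht : t < 1 := htq.trans_lt hq
  rw [← ofReal_integral_eq_lintegral_ofReal (integrable_exp_expMeasure_one ht)
    (ae_of_all _ fun _ => Real.exp_nonneg _), integral_exp_expMeasure_one ht]
  apply ENNReal.ofReal_le_ofReal
  have h1 : 0 < 1 - t := by linarith
  have h2 : 0 < 1 - q := by linarith
  have h3 : (1 - t)⁻¹ ≤ Real.exp (t / (1 - t)) := by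
    refine le_trans (le_of_eq ?_) (Real.add_one_le_exp _)
    field_simp
    ring
  calc ((1 - t) * Real.exp t)⁻¹ = (1 - t)⁻¹ * Real.exp (-t) := by
        rw [mul_inv, Real.exp_neg]
    _ ≤ Real.exp (t / (1 - t)) * Real.exp (-t) := by gcongr
    _ = Real.exp (t ^ 2 / (1 - t)) := by
        rw [← Real.exp_add]
        congr 1
        field_simp
        ring
    _ ≤ Real.exp (t ^ 2 / (1 - q)) := by gcongr

/-- Against Lebesgue measure the integrand is at least the constant e^{-t} on a half line. -/
lemma lintegral_exp_expMeasure_one_eq_top {t : ℝ} (ht : 1 ≤ t) :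
    ∫⁻ x : ℝ, ENNReal.ofReal (Real.exp (t * (x - 1))) ∂(expMeasure 1) = ∞ := by
  rw [expMeasure_one_eq, lintegral_withDensity_eq_lintegral_mul _ (by fun_prop) (by fun_prop),
    eq_top_iff]
  calc (∞ : ℝ≥0∞) = ∫⁻ x in Set.Ici (0 : ℝ), ENNReal.ofReal (Real.exp (-t)) := by
        simp [ENNReal.mul_top, Real.exp_pos]
    _ ≤ _ := by
        refine setLIntegral_mono' measurableSet_Ici fun x hx => ?_
        rw [Pi.mul_apply, ← ENNReal.ofReal_mul (Real.exp_nonneg _), ← Real.exp_add]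
        apply ENNReal.ofReal_le_ofReal
        apply Real.exp_le_exp.2
        have : (0 : ℝ) ≤ x := hx
        nlinarith

lemma memLp_two_expMeasure_one : MemLp (fun x : ℝ => x - 1) 2 (expMeasure 1) := by
  have : (0 : ℝ) ∈ interior (integrableExpSet (fun x : ℝ => x - 1) (expMeasure 1)) := by
    rw [mem_interior_iff_mem_nhds]
    filter_upwards [gt_mem_nhds (show (0 : ℝ) < 1 from one_pos)] with t ht
    exact integrable_exp_expMeasure_one ht
  exact_mod_cast memLp_of_mem_interior_integrableExpSet this 2

lemma integral_sub_one_expMeasure_one : ∫ x : ℝ, x - 1 ∂(expMeasure 1) = 0 := by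
  have := isProbabilityMeasure_expMeasure one_pos
  have h0 : (0 : ℝ) ∈ interior (integrableExpSet (fun x : ℝ => x - 1) (expMeasure 1)) := by
    rw [mem_interior_iff_mem_nhds]
    filter_upwards [gt_mem_nhds (show (0 : ℝ) < 1 from one_pos)] with t ht
    exact integrable_exp_expMeasure_one ht
  rw [← deriv_mgf_zero h0]
  have h1 : mgf (fun x : ℝ => x - 1) (expMeasure 1) =ᶠ[𝓝 0]
      fun t => ((1 - t) * Real.exp t)⁻¹ := by
    filter_upwards [gt_mem_nhds (show (0 : ℝ) < 1 from one_pos)] with t ht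
    exact integral_exp_expMeasure_one ht
  rw [h1.deriv_eq]
  have h2 : HasDerivAt (fun t : ℝ => (1 - t) * Real.exp t)
      (-1 * Real.exp 0 + (1 - 0) * Real.exp 0) 0 :=
    ((hasDerivAt_id (0 : ℝ)).const_sub 1).mul (Real.hasDerivAt_exp 0)
  have h3 := h2.inv (by simp)
  have h4 := h3.deriv
  simp only [Real.exp_zero] at h4
  exact h4.trans (by simp)

end ExpMeasure

/-! ### Uniform integrability from a moment of order above 1 -/

section UniformIntegrability

open scoped ENNReal NNReal

variable {Ω : Type*} [MeasurableSpace Ω] {P : Measure Ω} [IsFiniteMeasure P]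

lemma uniformIntegrable_of_lintegral_rpow_le {ι : Type*} {W : ι → Ω → ℂ}
    (hW : ∀ n, AEStronglyMeasurable (W n) P) {δ : ℝ} (hδ : 0 < δ) {C : ℝ≥0}
    (hC : ∀ n, ∫⁻ ω, ‖W n ω‖ₑ ^ (1 + δ) ∂P ≤ C) : UniformIntegrable W 1 P := by
  refine uniformIntegrable_of le_rfl ENNReal.one_ne_top hW ?_
  intro ε hε
  have hlim : Tendsto (fun K : ℝ => (C : ℝ) / K ^ δ) atTop (𝓝 0) :=
    tendsto_const_nhds.div_atTop (tendsto_rpow_atTop hδ)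
  obtain ⟨K, hK1, hK⟩ := ((hlim.eventually (gt_mem_nhds hε)).and (eventually_gt_atTop 0)).exists
  refine ⟨⟨K, hK.le⟩, fun n => ?_⟩
  have hKδ : 0 < K ^ δ := Real.rpow_pos_of_pos hK δ
  -- Where |W| ≥ K one has K^δ |W| ≤ |W|^(1+δ).
  have hle : ENNReal.ofReal (K ^ δ) *
      eLpNorm ({x | (⟨K, hK.le⟩ : ℝ≥0) ≤ ‖W n x‖₊}.indicator (W n)) 1 P ≤ C := by
    rw [eLpNorm_one_eq_lintegral_enorm, ← lintegral_const_mul' _ _ ENNReal.ofReal_ne_top]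
    refine le_trans (lintegral_mono fun ω => ?_) (hC n)
    by_cases h : (⟨K, hK.le⟩ : ℝ≥0) ≤ ‖W n ω‖₊
    · rw [Set.indicator_of_mem (by exact h), add_comm 1 δ,
        ENNReal.rpow_add_of_nonneg _ _ hδ.le zero_le_one, ENNReal.rpow_one]
      gcongr
      rw [← ENNReal.ofReal_rpow_of_pos hK]
      gcongr
      rw [← ofReal_norm]
      exact ENNReal.ofReal_le_ofReal h
    · rw [Set.indicator_of_notMem (by exact h)]
      simp
  rw [← mul_comm, ← ENNReal.le_div_iff_mul_le (by simp [hKδ]) (by simp)] at hle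
  refine hle.trans ?_
  rw [← ENNReal.ofReal_coe_nnreal, ← ENNReal.ofReal_div_of_pos hKδ]
  exact ENNReal.ofReal_le_ofReal hK1.le

lemma integrable_and_tendsto_integral_of_lintegral_rpow_le {W : ℕ → Ω → ℂ} {V : Ω → ℂ}
    (hW : ∀ n, AEStronglyMeasurable (W n) P) {δ : ℝ} (hδ : 0 < δ) {C : ℝ≥0}
    (hC : ∀ n, ∫⁻ ω, ‖W n ω‖ₑ ^ (1 + δ) ∂P ≤ C)
    (hV : ∀ᵐ ω ∂P, Tendsto (fun n => W n ω) atTop (𝓝 (V ω))) :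
    Integrable V P ∧ Tendsto (fun n => ∫ ω, W n ω ∂P) atTop (𝓝 (∫ ω, V ω ∂P)) := by
  have hui := uniformIntegrable_of_lintegral_rpow_le hW hδ hC
  have hint := hui.integrable_of_ae_tendsto hV
  refine ⟨hint, ?_⟩
  refine tendsto_integral_of_L1' V hint.1 (Eventually.of_forall fun n => ?_)
    (tendsto_Lp_finite_of_tendsto_ae le_rfl ENNReal.one_ne_top hW
      (memLp_one_iff_integrable.2 hint) hui.unifIntegrable hV)
  exact memLp_one_iff_integrable.1 (hui.memLp n)

end UniformIntegrability

/-! ### Series of independent centred exponentials -/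

section ExponentialSeries

open scoped ENNReal NNReal

variable {Ω : Type*} [MeasurableSpace Ω] {P : Measure Ω}

/-- A series of independent centred square integrable variables with summable variances converges
almost surely. -/
theorem ae_exists_tendsto_sum_of_summable_variance {Y : ℕ → Ω → ℝ}
    (hm : ∀ k, StronglyMeasurable (Y k)) (hind : iIndepFun Y P) (h2 : ∀ k, MemLp (Y k) 2 P)
    (h0 : ∀ k, ∫ ω, Y k ω ∂P = 0) (hvar : Summable fun k => variance (Y k) P) :
    ∀ᵐ ω ∂P, ∃ l, Tendsto (fun N => ∑ k ∈ Finset.range N, Y k ω) atTop (𝓝 l) := by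
  have := hind.isProbabilityMeasure
  -- Summing up to and including n makes `M n` measurable at time n of the natural filtration. The
  -- martingale is bounded in L¹ through |x| ≤ 1 + x².
  let M : ℕ → Ω → ℝ := fun n => ∑ k ∈ Finset.range (n + 1), Y k
  have hM2 : ∀ n, MemLp (M n) 2 P := fun n => memLp_finsetSum' _ fun k _ => h2 k
  have hMint : ∀ n, Integrable (M n) P := fun n => (hM2 n).integrable one_le_two
  have hmart : Martingale M (Filtration.natural Y hm) P := by
    have hadp : StronglyAdapted (Filtration.natural Y hm) M := fun n =>
      Finset.stronglyMeasurable_sum _ fun k hk =>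
        (Filtration.stronglyAdapted_natural hm k).mono
          ((Filtration.natural Y hm).mono (Nat.lt_succ_iff.1 (Finset.mem_range.1 hk)))
    refine martingale_nat hadp hMint fun n => ?_
    have e : M (n + 1) = M n + Y (n + 1) := Finset.sum_range_succ _ _
    rw [e]
    have h1 := condExp_add (hMint n) ((h2 (n + 1)).integrable one_le_two)
      (Filtration.natural Y hm n)
    have h3 := hind.condExp_natural_ae_eq_of_lt hm (Nat.lt_succ_self n)
    rw [condExp_of_stronglyMeasurable ((Filtration.natural Y hm).le n) (hadp n) (hMint n)] at h1
    filter_upwards [h1, h3] with ω h1 h3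
    rw [h1, Pi.add_apply, h3, h0, add_zero]
  have hbdd : ∀ n, eLpNorm (M n) 1 P ≤ (Real.toNNReal (1 + ∑' k, variance (Y k) P) : ℝ≥0) := by
    intro n
    have hM0 : ∫ ω, M n ω ∂P = 0 := by
      simp only [M, Finset.sum_apply]
      rw [integral_finsetSum _ fun k _ => (h2 k).integrable one_le_two]
      simp [h0]
    have hv : ∫ ω, M n ω ^ 2 ∂P ≤ ∑' k, variance (Y k) P := by
      rw [← variance_of_integral_eq_zero (hMint n).aemeasurable hM0,
        IndepFun.variance_sum (fun k _ => h2 k) (fun i _ j _ hij => hind.indepFun hij)]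
      exact hvar.sum_le_tsum _ fun k _ => variance_nonneg _ _
    rw [eLpNorm_one_eq_lintegral_enorm, ← ofReal_integral_norm_eq_lintegral_enorm (hMint n)]
    apply ENNReal.ofReal_le_ofReal
    calc ∫ ω, ‖M n ω‖ ∂P ≤ ∫ ω, 1 + M n ω ^ 2 ∂P := by
          refine integral_mono (hMint n).norm ((integrable_const 1).add (hM2 n).integrable_sq) ?_
          intro ω
          simp only [Real.norm_eq_abs]
          nlinarith [sq_abs (M n ω), sq_nonneg (|M n ω| - 1), abs_nonneg (M n ω)]
      _ = 1 + ∫ ω, M n ω ^ 2 ∂P := by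
          rw [integral_add (integrable_const 1) (hM2 n).integrable_sq]
          simp
      _ ≤ _ := by gcongr
  filter_upwards [hmart.submartingale.exists_ae_tendsto_of_bdd hbdd] with ω hω
  obtain ⟨l, hl⟩ := hω
  refine ⟨l, (tendsto_add_atTop_iff_nat 1).1 ?_⟩
  simpa [M] using hl

variable {Γ : ℕ → Ω → ℝ}

lemma ae_exists_tendsto_sum_real (hm : ∀ k, Measurable (Γ k))
    (hlaw : ∀ k, HasLaw (Γ k) (expMeasure 1) P) (hind : iIndepFun Γ P) {t : ℕ → ℝ}
    (ht : Summable fun k => t k ^ 2) :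
    ∀ᵐ ω ∂P, ∃ l, Tendsto (fun N => ∑ k ∈ Finset.range N, t k * (Γ k ω - 1)) atTop (𝓝 l) := by
  have := hind.isProbabilityMeasure
  have hL : ∀ k, MemLp (fun ω => Γ k ω - 1) 2 P := fun k => by
    have h := memLp_two_expMeasure_one
    rw [← (hlaw k).map_eq] at h
    exact (memLp_map_measure_iff h.1 (hm k).aemeasurable).1 h
  refine ae_exists_tendsto_sum_of_summable_variance (Y := fun k ω => t k * (Γ k ω - 1))
    (fun k => ((hm k).sub_const 1 |>.const_mul (t k)).stronglyMeasurable)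
    (hind.comp (fun k x => t k * (x - 1)) fun k => by fun_prop)
    (fun k => (hL k).const_mul (t k)) ?_ ?_
  · intro k
    have h := (hlaw k).integral_comp (f := fun x : ℝ => x - 1)
      memLp_two_expMeasure_one.1
    rw [integral_const_mul]
    have h' : ∫ ω, Γ k ω - 1 ∂P = 0 := h.trans integral_sub_one_expMeasure_one
    rw [h', mul_zero]
  · have hv : ∀ k, variance (fun ω => t k * (Γ k ω - 1)) P =
        t k ^ 2 * variance id (expMeasure 1) := by
      intro k
      rw [variance_const_mul, variance_sub_const (hm k).aestronglyMeasurable,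
        (hlaw k).variance_eq]
    simp_rw [hv]
    exact ht.mul_right _

lemma ae_exists_tendsto_sum_complex (hm : ∀ k, Measurable (Γ k))
    (hlaw : ∀ k, HasLaw (Γ k) (expMeasure 1) P) (hind : iIndepFun Γ P) {c : ℕ → ℂ}
    (hc : Summable fun k => ‖c k‖ ^ 2) :
    ∀ᵐ ω ∂P, ∃ l : ℂ,
      Tendsto (fun N => ∑ k ∈ Finset.range N, c k * ((Γ k ω : ℂ) - 1)) atTop (𝓝 l) := by
  have hre : Summable fun k => (c k).re ^ 2 := hc.of_nonneg_of_le (fun k => sq_nonneg _) fun k =>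
    sq_le_sq.2 (by simpa using Complex.abs_re_le_norm (c k))
  have him : Summable fun k => (c k).im ^ 2 := hc.of_nonneg_of_le (fun k => sq_nonneg _) fun k =>
    sq_le_sq.2 (by simpa using Complex.abs_im_le_norm (c k))
  filter_upwards [ae_exists_tendsto_sum_real hm hlaw hind hre,
    ae_exists_tendsto_sum_real hm hlaw hind him] with ω h1 h2
  obtain ⟨l1, h1⟩ := h1
  obtain ⟨l2, h2⟩ := h2
  refine ⟨(l1 : ℂ) + l2 * Complex.I, ?_⟩
  have h3 := ((Complex.continuous_ofReal.tendsto l1).comp h1).add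
    (((Complex.continuous_ofReal.tendsto l2).comp h2).mul_const Complex.I)
  refine h3.congr fun N => ?_
  simp only [Function.comp_apply]
  push_cast
  rw [Finset.sum_mul, ← Finset.sum_add_distrib]
  refine Finset.sum_congr rfl fun k _ => ?_
  conv_rhs => rw [← Complex.re_add_im (c k)]
  ring

/-- Since t k → 0, only finitely many terms exceed 1/2, and a maximum of finitely many numbers below
1 is below 1. -/
lemma exists_uniform_lt_one {t : ℕ → ℝ} (ht : Summable fun k => t k ^ 2) (h1 : ∀ k, t k < 1) :
    ∃ q : ℝ, 0 < q ∧ q < 1 ∧ ∀ k, t k ≤ q := by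
  have h2 : ∀ᶠ k in atTop, t k ≤ 1 / 2 := by
    filter_upwards [ht.tendsto_atTop_zero.eventually
      (gt_mem_nhds (show (0 : ℝ) < 1 / 4 by norm_num))] with k hk
    nlinarith
  obtain ⟨N, hN⟩ := eventually_atTop.1 h2
  have h3 : ∀ n : ℕ, ∃ q : ℝ, 1 / 2 ≤ q ∧ q < 1 ∧ ∀ k < n, t k ≤ q := by
    intro n
    induction n with
    | zero => exact ⟨1 / 2, le_rfl, by norm_num, by simp⟩
    | succ n ih =>
      obtain ⟨q, hq1, hq2, hq3⟩ := ih
      refine ⟨max q (t n), hq1.trans (le_max_left _ _), max_lt hq2 (h1 n), fun k hk => ?_⟩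
      rcases Nat.lt_succ_iff_lt_or_eq.1 hk with h | rfl
      · exact (hq3 k h).trans (le_max_left _ _)
      · exact le_max_right _ _
  obtain ⟨q, hq1, hq2, hq3⟩ := h3 N
  refine ⟨q, by linarith, hq2, fun k => ?_⟩
  rcases lt_or_ge k N with h | h
  · exact hq3 k h
  · exact (hN k h).trans hq1

lemma lintegral_prod_exp_le (hm : ∀ k, Measurable (Γ k))
    (hlaw : ∀ k, HasLaw (Γ k) (expMeasure 1) P) (hind : iIndepFun Γ P) {t : ℕ → ℝ} {q : ℝ}
    (ht : Summable fun k => t k ^ 2) (hq : q < 1) (htq : ∀ k, t k ≤ q) (N : ℕ) :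
    ∫⁻ ω, ∏ k ∈ Finset.range N, ENNReal.ofReal (Real.exp (t k * (Γ k ω - 1))) ∂P ≤
      ENNReal.ofReal (Real.exp ((∑' k, t k ^ 2) / (1 - q))) := by
  have h1 := lintegral_prod_eq_prod_lintegral_of_indepFun (Finset.range N)
    (fun k ω => ENNReal.ofReal (Real.exp (t k * (Γ k ω - 1))))
    (hind.comp (fun k x => ENNReal.ofReal (Real.exp (t k * (x - 1)))) fun k => by fun_prop)
    (fun k => by have := hm k; fun_prop)
  rw [h1]
  have h2 : ∀ k, ∫⁻ ω, ENNReal.ofReal (Real.exp (t k * (Γ k ω - 1))) ∂P ≤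
      ENNReal.ofReal (Real.exp (t k ^ 2 / (1 - q))) := fun k => by
    have h := (hlaw k).lintegral_comp (f := fun x : ℝ => ENNReal.ofReal (Real.exp (t k * (x - 1))))
      (by fun_prop)
    rw [h]
    exact lintegral_exp_expMeasure_one_le (htq k) hq
  refine (Finset.prod_le_prod' fun k _ => h2 k).trans ?_
  rw [← ENNReal.ofReal_prod_of_nonneg fun k _ => Real.exp_nonneg _, ← Real.exp_sum,
    ← Finset.sum_div]
  apply ENNReal.ofReal_le_ofReal
  apply Real.exp_le_exp.2
  have : 0 < 1 - q := by linarith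
  gcongr
  exact ht.sum_le_tsum _ fun k _ => sq_nonneg _

lemma integral_cexp_sum (hlaw : ∀ k, HasLaw (Γ k) (expMeasure 1) P) (hind : iIndepFun Γ P)
    {c : ℕ → ℂ} (hc : ∀ k, (c k).re < 1) (N : ℕ) :
    ∫ ω, Complex.exp (∑ k ∈ Finset.range N, c k * ((Γ k ω : ℂ) - 1)) ∂P =
      (∏ k ∈ Finset.range N, (1 - c k) * Complex.exp (c k))⁻¹ := by
  have hind' : iIndepFun (fun k : Fin N => Γ k) P := hind.precomp Fin.val_injective
  have h := hind'.integral_fun_prod_comp (f := fun (k : Fin N) (x : ℝ) => Complex.exp (c k * ((x : ℂ) - 1)))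
    (fun k => (hlaw k).aemeasurable) (fun k => by fun_prop)
  have e1 : ∀ ω, Complex.exp (∑ k ∈ Finset.range N, c k * ((Γ k ω : ℂ) - 1)) =
      ∏ k : Fin N, Complex.exp (c k * ((Γ k ω : ℂ) - 1)) := fun ω => by
    rw [Complex.exp_sum, Finset.prod_range]
  simp_rw [e1]
  rw [h, ← Finset.prod_inv_distrib, Finset.prod_range]
  refine Finset.prod_congr rfl fun k _ => ?_
  exact ((hlaw k).integral_comp (f := fun x : ℝ => Complex.exp (c k * ((x : ℂ) - 1)))
    (by fun_prop)).trans (integral_cexp_expMeasure_one (hc k))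

/-- The Laplace transform of the sum of a series of independent centred exponential variables. -/
theorem integrable_cexp_and_tendsto (hm : ∀ k, Measurable (Γ k))
    (hlaw : ∀ k, HasLaw (Γ k) (expMeasure 1) P) (hind : iIndepFun Γ P) {c : ℕ → ℂ}
    (hc : Summable fun k => ‖c k‖ ^ 2) (hc1 : ∀ k, (c k).re < 1) {V : Ω → ℂ}
    (hV : ∀ᵐ ω ∂P, Tendsto (fun N => ∑ k ∈ Finset.range N, c k * ((Γ k ω : ℂ) - 1)) atTop
      (𝓝 (V ω))) :
    Integrable (fun ω => Complex.exp (V ω)) P ∧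
      Tendsto (fun N => (∏ k ∈ Finset.range N, (1 - c k) * Complex.exp (c k))⁻¹) atTop
        (𝓝 (∫ ω, Complex.exp (V ω) ∂P)) := by
  have := hind.isProbabilityMeasure
  have hre : Summable fun k => (c k).re ^ 2 := hc.of_nonneg_of_le (fun k => sq_nonneg _) fun k =>
    sq_le_sq.2 (by simpa using Complex.abs_re_le_norm (c k))
  obtain ⟨q, hq0, hq1, hq⟩ := exists_uniform_lt_one hre hc1
  -- An exponent p > 1 with p·q = (q+1)/2 < 1, so the p-th powers still have transforms bounded
  -- uniformly in N.
  let p : ℝ := (1 + 1 / q) / 2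
  have hpq : p * q = (q + 1) / 2 := by simp only [p]; field_simp
  have hp1 : 1 < p := by
    have : 1 < 1 / q := by rw [lt_div_iff₀ hq0]; linarith
    simp only [p]; linarith
  have hp : 0 < p := by linarith
  have hpt : Summable fun k => (p * (c k).re) ^ 2 := by
    simp_rw [mul_pow]
    exact hre.mul_left _
  have hbound := lintegral_prod_exp_le hm hlaw hind (q := p * q) hpt (by rw [hpq]; linarith)
    (fun k => by have := hq k; gcongr)
  have hW : ∀ N, AEStronglyMeasurable
      (fun ω => Complex.exp (∑ k ∈ Finset.range N, c k * ((Γ k ω : ℂ) - 1))) P := fun N =>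
    Measurable.aestronglyMeasurable (by fun_prop)
  have key := integrable_and_tendsto_integral_of_lintegral_rpow_le hW (δ := p - 1) (by linarith)
    (C := (Real.exp ((∑' k, (p * (c k).re) ^ 2) / (1 - p * q))).toNNReal) (fun N => ?_)
    (V := fun ω => Complex.exp (V ω)) ?_
  · simp_rw [integral_cexp_sum hlaw hind hc1] at key
    exact key
  · refine le_trans (lintegral_mono fun ω => ?_) (hbound N)
    rw [← ofReal_norm, Complex.norm_exp, ENNReal.ofReal_rpow_of_pos (Real.exp_pos _),
      ← ENNReal.ofReal_prod_of_nonneg fun k _ => Real.exp_nonneg _, ← Real.exp_sum, ← Real.exp_mul]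
    apply ENNReal.ofReal_le_ofReal
    apply Real.exp_le_exp.2
    rw [Complex.re_sum, Finset.sum_mul]
    refine (Finset.sum_congr rfl fun k _ => ?_).le
    rw [← Complex.ofReal_one, ← Complex.ofReal_sub, Complex.re_mul_ofReal]
    ring
  · filter_upwards [hV] with ω hω
    exact (Complex.continuous_exp.tendsto _).comp hω

/-- Almost surely |e^V| = F·H, where F comes from the j-th variable and H > 0 from the others. By
independence E|e^V| = E F · E H, with E F = ∞ and E H > 0. -/
theorem not_integrable_cexp (hm : ∀ k, Measurable (Γ k))
    (hlaw : ∀ k, HasLaw (Γ k) (expMeasure 1) P) (hind : iIndepFun Γ P) {c : ℕ → ℂ}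
    {j : ℕ} (hj : 1 ≤ (c j).re) {V : Ω → ℂ}
    (hV : ∀ᵐ ω ∂P, Tendsto (fun N => ∑ k ∈ Finset.range N, c k * ((Γ k ω : ℂ) - 1)) atTop
      (𝓝 (V ω))) : ¬ Integrable (fun ω => Complex.exp (V ω)) P := by
  have := hind.isProbabilityMeasure
  let m : ℕ → MeasurableSpace Ω := fun k => MeasurableSpace.comap (Γ k) inferInstance
  have hmle : ∀ k, m k ≤ ‹MeasurableSpace Ω› := fun k => (hm k).comap_le
  have hindep : Indep (⨆ k ∈ ({j} : Set ℕ), m k) (⨆ k ∈ ({j}ᶜ : Set ℕ), m k) P :=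
    indep_iSup_of_disjoint hmle hind disjoint_compl_right
  let F : Ω → ℝ≥0∞ := fun ω => ENNReal.ofReal (Real.exp ((c j).re * (Γ j ω - 1)))
  let G : ℕ → Ω → ℝ≥0∞ := fun N ω =>
    ∏ k ∈ (Finset.range N).erase j, ENNReal.ofReal (Real.exp ((c k).re * (Γ k ω - 1)))
  -- `V` is only an almost sure limit; the limsup is defined everywhere and is measurable for the
  -- σ-algebra of the variables other than `Γ j`.
  let H : Ω → ℝ≥0∞ := fun ω => limsup (fun N => G N ω) atTop
  have hF : Measurable[⨆ k ∈ ({j} : Set ℕ), m k] F := by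
    have h1 : Measurable[m j] (Γ j) := comap_measurable _
    have h2 : Measurable[⨆ k ∈ ({j} : Set ℕ), m k] (Γ j) :=
      h1.mono (le_biSup m (Set.mem_singleton j)) le_rfl
    exact (show Measurable fun x : ℝ => ENNReal.ofReal (Real.exp ((c j).re * (x - 1))) by
      fun_prop).comp h2
  have hH : Measurable[⨆ k ∈ ({j}ᶜ : Set ℕ), m k] H := by
    have hlim : ∀ m' : MeasurableSpace Ω, (∀ N, ∀ k ∈ (Finset.range N).erase j, Measurable[m']
        fun ω => ENNReal.ofReal (Real.exp ((c k).re * (Γ k ω - 1)))) → Measurable[m'] H :=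
      fun m' h => Measurable.limsup fun N => Finset.measurable_fun_prod _ (h N)
    refine hlim _ fun N k hk => ?_
    have h1 : Measurable[m k] (Γ k) := comap_measurable _
    have h2 : Measurable[⨆ k ∈ ({j}ᶜ : Set ℕ), m k] (Γ k) :=
      h1.mono (le_biSup m (by simpa using Finset.ne_of_mem_erase hk)) le_rfl
    exact (show Measurable fun x : ℝ => ENNReal.ofReal (Real.exp ((c k).re * (x - 1))) by
      fun_prop).comp h2
  have hprod := lintegral_mul_eq_lintegral_mul_lintegral_of_independent_measurableSpace
    (iSup₂_le fun k _ => hmle k) (iSup₂_le fun k _ => hmle k) hindep hF hH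
  have hFtop : ∫⁻ ω, F ω ∂P = ∞ := by
    have h := (hlaw j).lintegral_comp
      (f := fun x : ℝ => ENNReal.ofReal (Real.exp ((c j).re * (x - 1)))) (by fun_prop)
    exact h.trans (lintegral_exp_expMeasure_one_eq_top hj)
  have hFH : ∀ᵐ ω ∂P, ‖Complex.exp (V ω)‖ₑ = F ω * H ω ∧ H ω ≠ 0 := by
    filter_upwards [hV] with ω hω
    have h1 : Tendsto (fun N => G N ω) atTop
        (𝓝 (ENNReal.ofReal (Real.exp ((V ω).re - (c j).re * (Γ j ω - 1))))) := by
      have h2 := ENNReal.tendsto_ofReal ((Real.continuous_exp.tendsto _).comp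
        (((Complex.continuous_re.tendsto _).comp hω).sub_const ((c j).re * (Γ j ω - 1))))
      refine h2.congr' ?_
      filter_upwards [eventually_gt_atTop j] with N hN
      simp only [Function.comp_apply, G]
      rw [← ENNReal.ofReal_prod_of_nonneg fun k _ => Real.exp_nonneg _, ← Real.exp_sum,
        Complex.re_sum, ← Finset.add_sum_erase _ _ (Finset.mem_range.2 hN)]
      have e : ∀ k, (c k * ((Γ k ω : ℂ) - 1)).re = (c k).re * (Γ k ω - 1) := fun k => by
        rw [← Complex.ofReal_one, ← Complex.ofReal_sub, Complex.re_mul_ofReal]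
      simp_rw [e]
      congr 2
      ring
    have h3 : H ω = ENNReal.ofReal (Real.exp ((V ω).re - (c j).re * (Γ j ω - 1))) := h1.limsup_eq
    rw [h3, ← ofReal_norm, Complex.norm_exp, ← ENNReal.ofReal_mul (Real.exp_nonneg _),
      ← Real.exp_add]
    refine ⟨by congr 2; ring, ?_⟩
    simp [Real.exp_pos]
  intro hint
  have hlt := hint.2
  rw [HasFiniteIntegral, lintegral_congr_ae (hFH.mono fun ω h => h.1), hprod, hFtop,
    ENNReal.top_mul] at hlt
  · exact lt_irrefl _ hlt
  · intro h0
    have hH' : Measurable H := hH.mono (iSup₂_le fun k _ => hmle k) le_rfl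
    rw [lintegral_eq_zero_iff hH'] at h0
    obtain ⟨ω, h1, h2⟩ := (h0.and (hFH.mono fun ω h => h.2)).exists
    exact h2 h1

end ExponentialSeries

/-! ### Moments from a Laplace transform near the origin -/

section Moments

variable {Ω : Type*} [MeasurableSpace Ω] {P : Measure Ω} {W : Ω → ℂ}

/-- |w| ≤ |Re w| + |Im w|, and the four directions realise all sign choices of ±Re w ± Im w. -/
lemma exp_mul_norm_le (s : ℝ) (hs : 0 ≤ s) (w : ℂ) : Real.exp (s * ‖w‖) ≤
    ‖Complex.exp ((s * (1 - Complex.I)) * w)‖ + ‖Complex.exp ((s * (1 + Complex.I)) * w)‖ +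
    (‖Complex.exp ((s * (-1 - Complex.I)) * w)‖ + ‖Complex.exp ((s * (-1 + Complex.I)) * w)‖) := by
  simp only [Complex.norm_exp]
  have h := mul_le_mul_of_nonneg_left (Complex.norm_le_abs_re_add_abs_im w) hs
  have e1 : ((s * (1 - Complex.I)) * w).re = s * (w.re + w.im) := by simp; ring
  have e2 : ((s * (1 + Complex.I)) * w).re = s * (w.re - w.im) := by simp; ring
  have e3 : ((s * (-1 - Complex.I)) * w).re = s * (-w.re + w.im) := by simp; ring
  have e4 : ((s * (-1 + Complex.I)) * w).re = s * (-w.re - w.im) := by simp; ring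
  rw [e1, e2, e3, e4]
  refine (Real.exp_le_exp.2 h).trans ?_
  have p1 := Real.exp_pos (s * (w.re + w.im))
  have p2 := Real.exp_pos (s * (w.re - w.im))
  have p3 := Real.exp_pos (s * (-w.re + w.im))
  have p4 := Real.exp_pos (s * (-w.re - w.im))
  rcases abs_choice w.re with h1 | h1 <;> rcases abs_choice w.im with h2 | h2 <;> rw [h1, h2]
  · linarith
  · rw [← sub_eq_add_neg]; linarith
  · linarith
  · rw [← sub_eq_add_neg]; linarith

lemma integrable_exp_mul_norm (hW : AEMeasurable W P) {r : ℝ} (hr : 0 < r)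
    (hint : ∀ z : ℂ, ‖z‖ < r → Integrable (fun ω => Complex.exp (z * W ω)) P) :
    Integrable (fun ω => Real.exp (r / 4 * ‖W ω‖)) P := by
  -- The directions ±1 ± i have modulus at most 2, so the factor r/4 keeps the argument within r/2 <
  -- r.
  have hz : ∀ u : ℂ, ‖u‖ ≤ 2 →
      Integrable (fun ω => ‖Complex.exp ((((r / 4 : ℝ) : ℂ) * u) * W ω)‖) P := fun u hu => by
    refine (hint _ ?_).norm
    rw [norm_mul, Complex.norm_real, Real.norm_of_nonneg (by positivity)]
    nlinarith
  have hI : ‖Complex.I‖ = 1 := Complex.norm_I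
  refine (((hz (1 - Complex.I) ?_).add (hz (1 + Complex.I) ?_)).add
    ((hz (-1 - Complex.I) ?_).add (hz (-1 + Complex.I) ?_))).mono' ?_ (ae_of_all _ fun ω => ?_)
  · exact (norm_sub_le _ _).trans (by norm_num)
  · exact (norm_add_le _ _).trans (by norm_num)
  · exact (norm_sub_le _ _).trans (by norm_num)
  · exact (norm_add_le _ _).trans (by norm_num)
  · exact (Real.measurable_exp.comp_aemeasurable (hW.norm.const_mul _)).aestronglyMeasurable
  · rw [Real.norm_of_nonneg (Real.exp_nonneg _)]
    exact exp_mul_norm_le _ (by positivity) _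

lemma integrable_pow_of_integrable_exp_mul_norm (hW : AEMeasurable W P) {s : ℝ} (hs : 0 < s)
    (hint : Integrable (fun ω => Real.exp (s * ‖W ω‖)) P) (n : ℕ) :
    Integrable (fun ω => W ω ^ n) P := by
  refine (hint.const_mul (n.factorial / s ^ n)).mono' (hW.pow_const n).aestronglyMeasurable
    (ae_of_all _ fun ω => ?_)
  have h := Real.pow_div_factorial_le_exp (x := s * ‖W ω‖) (by positivity) n
  rw [div_le_iff₀ (by positivity), mul_pow] at h
  rw [norm_pow, div_mul_eq_mul_div, le_div_iff₀ (by positivity)]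
  linarith

lemma hasSum_moments (hW : AEMeasurable W P) {s : ℝ}
    (hint : Integrable (fun ω => Real.exp (s * ‖W ω‖)) P) {z : ℂ} (hz : ‖z‖ ≤ s) :
    HasSum (fun n : ℕ => z ^ n * ((∫ ω, W ω ^ n ∂P) / n.factorial))
      (∫ ω, Complex.exp (z * W ω) ∂P) := by
  have h := hasSum_integral_of_dominated_convergence (μ := P)
    (F := fun (n : ℕ) ω => (z * W ω) ^ n / (n.factorial : ℂ))
    (f := fun ω => Complex.exp (z * W ω))
    (fun n ω => ‖z * W ω‖ ^ n / n.factorial)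
    (fun n => (((hW.const_mul z).pow_const n).div_const _).aestronglyMeasurable)
    (fun n => ae_of_all _ fun ω => by simp)
    (ae_of_all _ fun ω => Real.summable_pow_div_factorial _)
    ?_ (ae_of_all _ fun ω => by
      rw [Complex.exp_eq_exp_ℂ]
      exact NormedSpace.expSeries_div_hasSum_exp _)
  · simp_rw [mul_pow, mul_div_assoc, integral_const_mul, integral_div] at h
    exact h
  · have e : ∀ ω, ∑' n : ℕ, ‖z * W ω‖ ^ n / n.factorial = Real.exp ‖z * W ω‖ := fun ω => by
      rw [Real.exp_eq_exp_ℝ, NormedSpace.exp_eq_tsum_div]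
    simp_rw [e]
    refine hint.mono' (Real.measurable_exp.comp_aemeasurable
      (hW.const_mul z).norm).aestronglyMeasurable (ae_of_all _ fun ω => ?_)
    rw [Real.norm_of_nonneg (Real.exp_nonneg _), norm_mul]
    gcongr

/-- A complex random variable whose Laplace transform is `1` near the origin has vanishing
moments. -/
theorem integrable_pow_and_integral_eq (hW : AEMeasurable W P) {r : ℝ} (hr : 0 < r)
    (hint : ∀ z : ℂ, ‖z‖ < r → Integrable (fun ω => Complex.exp (z * W ω)) P)
    (h1 : ∀ z : ℂ, ‖z‖ < r → ∫ ω, Complex.exp (z * W ω) ∂P = 1) (n : ℕ) :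
    Integrable (fun ω => W ω ^ n) P ∧ ∫ ω, W ω ^ n ∂P = if n = 0 then 1 else 0 := by
  have hexp := integrable_exp_mul_norm hW hr hint
  have hr4 : 0 < r / 4 := by positivity
  refine ⟨integrable_pow_of_integrable_exp_mul_norm hW hr4 hexp n, ?_⟩
  -- The moment series and the trivial series both represent the constant 1, so their coefficients
  -- agree.
  have hp : HasFPowerSeriesAt (fun _ : ℂ => (1 : ℂ)) (FormalMultilinearSeries.ofScalars ℂ
      fun n : ℕ => (∫ ω, W ω ^ n ∂P) / (n.factorial : ℂ)) 0 := by
    rw [hasFPowerSeriesAt_iff]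
    filter_upwards [Metric.ball_mem_nhds (0 : ℂ) hr4] with z hz
    rw [mem_ball_zero_iff] at hz
    have := hasSum_moments hW hexp hz.le
    rw [h1 z (by linarith)] at this
    simpa [FormalMultilinearSeries.coeff_ofScalars] using this
  have hq : HasFPowerSeriesAt (fun _ : ℂ => (1 : ℂ)) (FormalMultilinearSeries.ofScalars ℂ
      fun n : ℕ => if n = 0 then (1 : ℂ) else 0) 0 := by
    rw [hasFPowerSeriesAt_iff]
    refine Eventually.of_forall fun z => ?_
    have := hasSum_single (f := fun n : ℕ => z ^ n * if n = 0 then (1 : ℂ) else 0) 0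
      (fun n hn => by simp [hn])
    simpa [FormalMultilinearSeries.coeff_ofScalars] using this
  have h := congrArg (fun p : FormalMultilinearSeries ℂ ℂ ℂ => p.coeff n)
    (hp.eq_formalMultilinearSeries hq)
  simp only [FormalMultilinearSeries.coeff_ofScalars] at h
  have hf : (n.factorial : ℂ) ≠ 0 := by exact_mod_cast n.factorial_ne_zero
  rw [div_eq_iff hf] at h
  rw [h]
  split_ifs with hn
  · simp [hn]
  · simp

end Moments

/-! ### The Kummer function as transform of the beta law -/

section Beta

open scoped ENNReal

variable {a b : ℝ}

lemma beta_add_natCast_div_beta (ha : 0 < a) (hb : 0 < b) (n : ℕ) :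
    beta (a + n) b / beta a b =
      (ascPochhammer ℝ n).eval a / (ascPochhammer ℝ n).eval (a + b) := by
  have key : ∀ x : ℝ, 0 < x → Real.Gamma (x + n) = (ascPochhammer ℝ n).eval x * Real.Gamma x := by
    intro x hx
    induction n with
    | zero => simp
    | succ n ih =>
      rw [ascPochhammer_succ_eval, Nat.cast_succ, ← add_assoc,
        Real.Gamma_add_one (by positivity), ih]
      ring
  have h1 := ascPochhammer_pos n (a + b) (by positivity)
  have h2 := Real.Gamma_pos_of_pos ha
  have h3 := Real.Gamma_pos_of_pos hb
  have h4 := Real.Gamma_pos_of_pos (add_pos ha hb)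
  rw [beta, beta, add_right_comm, key a ha, key (a + b) (add_pos ha hb)]
  field_simp

lemma ae_betaMeasure_mem_Ioo : ∀ᵐ x ∂(betaMeasure a b), x ∈ Set.Ioo (0 : ℝ) 1 := by
  rw [betaMeasure, ae_withDensity_iff' (by unfold betaPDF; fun_prop)]
  refine ae_of_all _ fun x hx => ?_
  by_contra h
  rw [Set.mem_Ioo] at h
  exact hx (by rw [betaPDF_eq, if_neg h, ENNReal.ofReal_zero])

/-- x^n times the beta(a, b) density is a multiple of the beta(a+n, b) density. -/
lemma integral_pow_betaMeasure (ha : 0 < a) (hb : 0 < b) (n : ℕ) :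
    ∫ x, x ^ n ∂(betaMeasure a b) =
      (ascPochhammer ℝ n).eval a / (ascPochhammer ℝ n).eval (a + b) := by
  have hpos : 0 < beta (a + n) b / beta a b :=
    div_pos (beta_pos (by positivity) hb) (beta_pos ha hb)
  rw [← beta_add_natCast_div_beta ha hb]
  rw [integral_eq_lintegral_of_nonneg_ae
    (ae_betaMeasure_mem_Ioo.mono fun x hx => pow_nonneg hx.1.le n) (by fun_prop)]
  rw [betaMeasure, lintegral_withDensity_eq_lintegral_mul _ (by unfold betaPDF; fun_prop)
    (by fun_prop)]
  have e : ∀ x : ℝ, (betaPDF a b * fun x => ENNReal.ofReal (x ^ n)) x =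
      ENNReal.ofReal (beta (a + n) b / beta a b) * betaPDF (a + n) b x := by
    intro x
    rw [Pi.mul_apply, betaPDF_eq, betaPDF_eq]
    split_ifs with hx
    · rw [← ENNReal.ofReal_mul' (by have := hx.1; positivity), ← ENNReal.ofReal_mul hpos.le]
      congr 1
      have h1 := beta_pos (α := a + n) (by positivity) hb
      have h2 := beta_pos ha hb
      have h3 : x ^ (a + n - 1) = x ^ (a - 1) * x ^ n := by
        rw [← Real.rpow_natCast, ← Real.rpow_add hx.1]
        ring_nf
      rw [h3]
      field_simp
    · simp
  simp_rw [e]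
  rw [lintegral_const_mul' _ _ ENNReal.ofReal_ne_top,
    lintegral_betaPDF_eq_one (by positivity) hb, mul_one, ENNReal.toReal_ofReal hpos.le]

lemma integrable_exp_mul_betaMeasure (ha : 0 < a) (hb : 0 < b) (t : ℝ) :
    Integrable (fun x => Real.exp (t * x)) (betaMeasure a b) := by
  have := isProbabilityMeasureBeta ha hb
  refine (integrable_const (Real.exp |t|)).mono' (by fun_prop)
    (ae_betaMeasure_mem_Ioo.mono fun x hx => ?_)
  rw [Real.norm_of_nonneg (Real.exp_nonneg _)]
  apply Real.exp_le_exp.2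
  have h1 := hx.1
  have h2 := hx.2
  calc t * x ≤ |t| * x := by gcongr; exact le_abs_self t
    _ ≤ |t| * 1 := by gcongr
    _ = |t| := mul_one _

lemma kummerPhi_eq_complexMGF (ha : 0 < a) (hb : 0 < b) (z : ℂ) :
    kummerPhi a b z = complexMGF id (betaMeasure a b) z := by
  have h := hasSum_moments (P := betaMeasure a b) (W := fun x => (x : ℂ)) (s := ‖z‖)
    (by fun_prop) (by
      refine (integrable_exp_mul_betaMeasure ha hb ‖z‖).congr
        (ae_betaMeasure_mem_Ioo.mono fun x hx => ?_)
      simp [abs_of_pos hx.1]) (z := z) le_rfl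
  have e := h.tsum_eq
  rw [complexMGF]
  simp only [id]
  rw [← e, kummerPhi, kummerM]
  congr with n
  rw [← integral_pow_betaMeasure ha hb, ← integral_complex_ofReal]
  push_cast
  ring

lemma mem_interior_integrableExpSet_betaMeasure (ha : 0 < a) (hb : 0 < b) (t : ℝ) :
    t ∈ interior (integrableExpSet id (betaMeasure a b)) := by
  have : integrableExpSet id (betaMeasure a b) = Set.univ :=
    Set.eq_univ_of_forall fun t => integrable_exp_mul_betaMeasure ha hb t
  simp [this]

lemma hasDerivAt_kummerPhi (ha : 0 < a) (hb : 0 < b) (z : ℂ) :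
    HasDerivAt (kummerPhi a b) (∫ x : ℝ, x * Complex.exp (z * x) ∂(betaMeasure a b)) z := by
  have h : kummerPhi a b = complexMGF id (betaMeasure a b) :=
    funext (kummerPhi_eq_complexMGF ha hb)
  rw [h]
  exact hasDerivAt_complexMGF (mem_interior_integrableExpSet_betaMeasure ha hb z.re)

lemma differentiable_kummerPhi (ha : 0 < a) (hb : 0 < b) : Differentiable ℂ (kummerPhi a b) :=
  fun z => (hasDerivAt_kummerPhi ha hb z).differentiableAt

lemma deriv_kummerPhi_zero (ha : 0 < a) (hb : 0 < b) :
    deriv (kummerPhi a b) 0 = ((a / (a + b) : ℝ) : ℂ) := by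
  rw [(hasDerivAt_kummerPhi ha hb 0).deriv]
  have h := integral_pow_betaMeasure ha hb 1
  simp only [pow_one, ascPochhammer_one, Polynomial.eval_X] at h
  rw [← h, ← integral_complex_ofReal]
  simp

lemma kummerPhi_zero (ha : 0 < a) (hb : 0 < b) : kummerPhi a b 0 = 1 := by
  have := isProbabilityMeasureBeta ha hb
  simp [kummerPhi_eq_complexMGF ha hb, complexMGF]

lemma norm_kummerPhi_le (ha : 0 < a) (hb : 0 < b) (z : ℂ) :
    ‖kummerPhi a b z‖ ≤ Real.exp ‖z‖ := by
  have := isProbabilityMeasureBeta ha hb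
  rw [kummerPhi_eq_complexMGF ha hb, complexMGF]
  refine (norm_integral_le_of_norm_le_const (C := Real.exp ‖z‖)
    (ae_betaMeasure_mem_Ioo.mono fun x hx => ?_)).trans (by simp)
  refine (Complex.norm_exp_le_exp_norm _).trans (Real.exp_le_exp.2 ?_)
  rw [norm_mul, id, Complex.norm_real, Real.norm_of_nonneg hx.1.le]
  exact mul_le_of_le_one_right (norm_nonneg _) hx.2.le

/-- On the imaginary axis this is the Fourier transform of the integrable beta density, so the
Riemann–Lebesgue lemma applies. -/
lemma tendsto_kummerPhi_cocompact (ha : 0 < a) (hb : 0 < b) :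
    Tendsto (fun w : ℝ => kummerPhi a b (-(2 * Real.pi * w : ℝ) * Complex.I)) (cocompact ℝ)
      (𝓝 0) := by
  refine (Real.tendsto_integral_exp_smul_cocompact
    (fun x => ((betaPDFReal a b x : ℝ) : ℂ))).congr fun w => ?_
  rw [kummerPhi_eq_complexMGF ha hb, complexMGF,
    show betaMeasure a b = volume.withDensity (fun x => ENNReal.ofReal (betaPDFReal a b x)) from rfl,
    integral_withDensity_eq_integral_toReal_smul (by fun_prop)
    (ae_of_all _ fun _ => ENNReal.ofReal_lt_top)]
  congr with x
  have h0 : 0 ≤ betaPDFReal a b x := by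
    by_cases hx : 0 < x ∧ x < 1
    · exact (betaPDFReal_pos hx.1 hx.2 ha hb).le
    · rw [betaPDFReal, if_neg hx]
  rw [ENNReal.toReal_ofReal h0, Circle.smul_def, Real.fourierChar_apply,
    Complex.real_smul, smul_eq_mul, mul_comm]
  congr 2
  simp only [id]
  push_cast
  ring

end Beta

/-! ### Existence of an infinite sequence of zeros -/

section Zeros

variable {a b : ℝ}

/-- A function of exponential type that decays along the imaginary axis has infinitely many
zeros. -/
theorem IsZeroFamily.infinite {ι : Type*} {f : ℂ → ℂ} {ζ : ι → ℂ} (hζ : IsZeroFamily f ζ)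
    (hf : Differentiable ℂ f) (hf0 : f 0 = 1) (hfb : ∀ z, ‖f z‖ ≤ Real.exp ‖z‖)
    (hlim : Tendsto (fun w : ℝ => f (-(2 * Real.pi * w : ℝ) * Complex.I)) (cocompact ℝ) (𝓝 0)) :
    Infinite ι := by
  by_contra hfin
  rw [not_infinite_iff_finite] at hfin
  have := Fintype.ofFinite ι
  let c : ℂ := deriv f 0 + ∑ k, 1 / ζ k
  have hfac : ∀ z, f z = Complex.exp (c * z) * ∏ k, (1 - z / ζ k) := by
    intro z
    have h := (hasProd_fintype _).unique (hζ.hasProd hf hf0 hfb z)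
    rw [Finset.prod_mul_distrib, ← Complex.exp_sum, Complex.exp_neg] at h
    have h2 := Complex.exp_ne_zero (deriv f 0 * z)
    have h3 : c * z = ∑ k, z / ζ k + deriv f 0 * z := by
      simp only [c, add_mul, Finset.sum_mul]
      rw [add_comm]
      congr 1
      exact Finset.sum_congr rfl fun k _ => by ring
    rw [h3, Complex.exp_add, mul_right_comm, mul_comm (Complex.exp _) (∏ k, _), h,
      inv_mul_cancel_right₀ h2]
  -- The sign s selects the half of the imaginary axis on which |e^{cz}| ≥ 1. Far out every linear
  -- factor also has modulus at least 1, so `f` cannot tend to 0 there.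
  obtain ⟨s, hs1, hs2⟩ : ∃ s : ℝ, |s| = 1 ∧ 0 ≤ s * c.im := by
    rcases le_total 0 c.im with h | h
    · exact ⟨1, by simp, by simpa using h⟩
    · exact ⟨-1, by simp, by linarith⟩
  have htop : Tendsto (fun n : ℕ => s * (n : ℝ)) atTop (cocompact ℝ) := by
    rw [← Real.norm_eq_abs] at hs1
    rw [← Metric.cobounded_eq_cocompact, ← tendsto_norm_atTop_iff_cobounded]
    simp only [norm_mul, hs1, one_mul, Real.norm_natCast]
    exact tendsto_natCast_atTop_atTop
  have h1 := (hlim.comp htop).norm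
  rw [norm_zero] at h1
  have h2 : ∀ᶠ n : ℕ in atTop, ∀ k, 2 * ‖ζ k‖ ≤ n :=
    eventually_all.2 fun k => tendsto_natCast_atTop_atTop.eventually_ge_atTop _
  obtain ⟨n, hn1, hn2⟩ := ((h1.eventually (gt_mem_nhds one_pos)).and h2).exists
  simp only [Function.comp_apply] at hn1
  rw [hfac, norm_mul, Complex.norm_exp, norm_prod] at hn1
  set z : ℂ := -((2 * Real.pi * (s * n) : ℝ) : ℂ) * Complex.I with hz
  have hpi := Real.pi_gt_three
  have hzn : (n : ℝ) ≤ ‖z‖ := by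
    rw [hz, norm_mul, norm_neg, Complex.norm_I, mul_one, Complex.norm_real, Real.norm_eq_abs,
      abs_mul, abs_mul s, hs1, one_mul, Nat.abs_cast, abs_of_pos (by positivity)]
    exact le_mul_of_one_le_left (by positivity) (by linarith)
  have hre : 0 ≤ (c * z).re := by
    have e : (c * z).re = 2 * Real.pi * n * (s * c.im) := by
      rw [hz]
      simp [-Complex.ofReal_mul]
      ring
    rw [e]
    positivity
  have hexp : 1 ≤ Real.exp (c * z).re := Real.one_le_exp hre
  have hprod : 1 ≤ ∏ k, ‖1 - z / ζ k‖ := by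
    refine Finset.one_le_prod fun k _ => ?_
    have h0 := norm_pos_iff.2 (hζ.ne_zero hf0 k)
    have h5 : 2 ≤ ‖z / ζ k‖ := by
      rw [norm_div, le_div_iff₀ h0]
      exact (hn2 k).trans hzn
    have h6 := norm_sub_norm_le (z / ζ k) 1
    rw [norm_sub_rev, norm_one] at h6
    linarith
  exact absurd hn1 (not_lt.2 (one_le_mul_of_one_le_of_one_le hexp hprod))

/-- The zeros of an entire function that is not identically zero, with multiplicity. -/
lemma isZeroFamily_zeros {f : ℂ → ℂ} (hf : Differentiable ℂ f) (hf0 : f 0 ≠ 0) :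
    IsZeroFamily f (fun k : (Σ w : {w : ℂ // f w = 0}, Fin (analyticOrderNatAt f w)) =>
      (k.1 : ℂ)) := by
  intro w
  -- By the identity theorem orders are finite; `analyticOrderNatAt` would turn an infinite order
  -- into 0.
  have htop : analyticOrderAt f w ≠ ⊤ := by
    intro h
    have hw : ∀ᶠ z in 𝓝 w, f z = 0 := analyticOrderAt_eq_top.1 h
    have han : AnalyticOnNhd ℂ f Set.univ := fun z _ => hf.analyticAt z
    exact hf0 (han.eqOn_zero_of_preconnected_of_eventuallyEq_zero isPreconnected_univ
      (Set.mem_univ w) hw (Set.mem_univ 0))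
  by_cases hw : f w = 0
  · have h : {k : (Σ w : {w : ℂ // f w = 0}, Fin (analyticOrderNatAt f w)) | (k.1 : ℂ) = w} =
        Set.range (fun i : Fin (analyticOrderNatAt f w) =>
          (⟨⟨w, hw⟩, i⟩ : Σ w : {w : ℂ // f w = 0}, Fin (analyticOrderNatAt f w))) := by
      ext ⟨⟨v, hv⟩, i⟩
      constructor
      · rintro rfl
        exact ⟨i, rfl⟩
      · rintro ⟨j, hj⟩
        exact (congrArg (fun k => (k.1 : ℂ)) hj).symm
    rw [h, ← Set.image_univ, Function.Injective.encard_image fun i j hij => by simpa using hij]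
    simp [htop]
  · rw [((hf.analyticAt w).analyticOrderAt_eq_zero).2 hw, Set.encard_eq_zero]
    ext ⟨⟨v, hv⟩, i⟩
    simp only [Set.mem_ofPred_eq, Set.mem_empty_iff_false, iff_false]
    rintro rfl
    exact hw hv

/-- Each disc contains finitely many zeros, so the index type is countable; being infinite, it can
be enumerated by ℕ. -/
theorem exists_isZeroSequence_kummerPhi (ha : 0 < a) (hb : 0 < b) :
    ∃ ζ : ℕ → ℂ, IsZeroSequence (kummerPhi a b) ζ := by
  have hf := differentiable_kummerPhi ha hb
  have hf0 := kummerPhi_zero ha hb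
  have hfb := norm_kummerPhi_le ha hb
  have hζ := isZeroFamily_zeros hf (by rw [hf0]; exact one_ne_zero)
  set ι := Σ w : {w : ℂ // kummerPhi a b w = 0}, Fin (analyticOrderNatAt (kummerPhi a b) w)
  set ξ : ι → ℂ := fun k => (k.1 : ℂ)
  have hinf : Infinite ι := hζ.infinite hf hf0 hfb (tendsto_kummerPhi_cocompact ha hb)
  have hcount : Countable ι := by
    rw [← Set.countable_univ_iff]
    refine (Set.countable_iUnion fun n : ℕ => (hζ.finite_norm_le hf hf0 hfb n).countable).mono ?_
    intro k _
    obtain ⟨n, hn⟩ := exists_nat_ge ‖ξ k‖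
    exact Set.mem_iUnion.2 ⟨n, hn⟩
  obtain ⟨e⟩ : Nonempty (ℕ ≃ ι) := nonempty_equiv_of_countable
  refine ⟨ξ ∘ e, fun w => ?_⟩
  rw [← hζ w]
  have : {k : ℕ | (ξ ∘ e) k = w} = e ⁻¹' {k | ξ k = w} := rfl
  rw [this, Set.encard_preimage_of_bijective e.bijective]

end Zeros

/-- `HasLaw` gives only almost everywhere measurability, while the filtration and the generated
σ-algebras need measurable variables. -/
lemma exists_measurable_modification {Ω : Type*} [MeasurableSpace Ω] {P : Measure Ω}
    {Γ : ℕ → Ω → ℝ} (hlaw : ∀ k, HasLaw (Γ k) (expMeasure 1) P) (hind : iIndepFun Γ P) :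
    ∃ Γ' : ℕ → Ω → ℝ, (∀ k, Measurable (Γ' k)) ∧ (∀ k, HasLaw (Γ' k) (expMeasure 1) P) ∧
      iIndepFun Γ' P ∧ ∀ᵐ ω ∂P, ∀ k, Γ' k ω = Γ k ω := by
  have h : ∀ k, Γ k =ᵐ[P] (hlaw k).aemeasurable.mk (Γ k) := fun k => (hlaw k).aemeasurable.ae_eq_mk
  exact ⟨fun k => (hlaw k).aemeasurable.mk (Γ k), fun k => (hlaw k).aemeasurable.measurable_mk,
    fun k => (hlaw k).congr (h k).symm, hind.congr h, ae_all_iff.2 fun k => (h k).symm⟩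

/-! ### Proof of the theorem -/

theorem mainTheorem8 (a b : ℝ) (ha : 0 < a) (hb : 0 < b) :
    (∃ ζ : ℕ → ℂ, IsZeroSequence (kummerPhi a b) ζ) ∧
    ∀ ζ : ℕ → ℂ, IsZeroSequence (kummerPhi a b) ζ →
    ∀ {Ω : Type*} [MeasurableSpace Ω] (P : Measure Ω) [IsProbabilityMeasure P]
      (Γ : ℕ → Ω → ℝ), (∀ k, HasLaw (Γ k) (expMeasure 1) P) → iIndepFun Γ P →
      AEMeasurable (zVariable a b ζ Γ) P ∧
      (∀ᵐ ω ∂P, Tendsto (fun N : ℕ => zPartialSum a b ζ Γ N ω) atTop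
        (𝓝 (zVariable a b ζ Γ ω))) ∧
      (∀ z : ℂ, Integrable (fun ω => Complex.exp (z * zVariable a b ζ Γ ω)) P ↔
        ∀ k, (z / ζ k).re < 1) ∧
      (∀ z : ℂ, (∀ k, (z / ζ k).re < 1) →
        ∫ ω, Complex.exp (z * zVariable a b ζ Γ ω) ∂P = 1 / kummerPhi a b z) ∧
      ∀ B : Ω → ℝ, HasLaw B (betaMeasure a b) P → IndepFun B (zVariable a b ζ Γ) P →
        AreConjugate (fun ω => (B ω : ℂ)) (zVariable a b ζ Γ) P := by
  refine ⟨exists_isZeroSequence_kummerPhi ha hb, ?_⟩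
  intro ζ hζ' Ω _ P _ Γ hlaw hind
  have hζ : IsZeroFamily (kummerPhi a b) ζ := hζ'
  have hf := differentiable_kummerPhi ha hb
  have hf0 := kummerPhi_zero ha hb
  have hfb := norm_kummerPhi_le ha hb
  obtain ⟨Γ', hm', hlaw', hind', hΓ⟩ := exists_measurable_modification hlaw hind
  set d : ℂ := ((a / (a + b) : ℝ) : ℂ) with hd
  set Z := zVariable a b ζ Γ with hZ
  have hsum : ∀ z : ℂ, Summable fun k => ‖z / ζ k‖ ^ 2 := fun z => by
    simp_rw [norm_div, div_pow, div_eq_mul_inv]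
    exact (hζ.summable_inv_norm_sq hf hf0 hfb).mul_left _
  have hconv : ∀ᵐ ω ∂P, Tendsto (fun N : ℕ => zPartialSum a b ζ Γ N ω) atTop (𝓝 (Z ω)) := by
    filter_upwards [ae_exists_tendsto_sum_complex hm' hlaw' hind' (hsum 1), hΓ] with ω hω hΓω
    obtain ⟨l, hl⟩ := hω
    refine tendsto_nhds_limUnder ⟨-d + l, (hl.const_add (-d)).congr fun N => ?_⟩
    simp only [zPartialSum, hd, hΓω]
    congr 1
    exact Finset.sum_congr rfl fun k _ => by ring
  have hZm : AEMeasurable Z P := by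
    refine aemeasurable_of_tendsto_metrizable_ae atTop (fun N => ?_) hconv
    have := fun k => (hlaw k).aemeasurable
    unfold zPartialSum
    fun_prop
  -- Adding d = Φ'(0) cancels the constant in `zPartialSum` and leaves the pure series; the factor
  -- e^{-dz} restored by `hexp` cancels the exponential in Hadamard's product.
  have hV : ∀ z : ℂ, ∀ᵐ ω ∂P, Tendsto
      (fun N => ∑ k ∈ Finset.range N, z / ζ k * ((Γ' k ω : ℂ) - 1)) atTop
      (𝓝 (z * (d + Z ω))) := fun z => by
    filter_upwards [hconv, hΓ] with ω hω hΓω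
    refine ((hω.const_add d).const_mul z).congr fun N => ?_
    simp only [zPartialSum, ← hd, hΓω]
    rw [add_neg_cancel_left, Finset.mul_sum]
    exact Finset.sum_congr rfl fun k _ => by ring
  have hexp : ∀ z ω, Complex.exp (z * Z ω) =
      Complex.exp (-(d * z)) * Complex.exp (z * (d + Z ω)) := fun z ω => by
    rw [← Complex.exp_add]
    congr 1
    ring
  have hiff : ∀ z : ℂ, Integrable (fun ω => Complex.exp (z * Z ω)) P ↔
      ∀ k, (z / ζ k).re < 1 := fun z => by
    simp_rw [hexp]
    rw [integrable_const_mul_iff (Complex.exp_ne_zero _).isUnit]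
    refine ⟨fun h k => ?_, fun h =>
      (integrable_cexp_and_tendsto hm' hlaw' hind' (hsum z) h (hV z)).1⟩
    by_contra hk
    exact not_integrable_cexp hm' hlaw' hind' (not_lt.1 hk) (hV z) h
  have hval : ∀ z : ℂ, (∀ k, (z / ζ k).re < 1) →
      ∫ ω, Complex.exp (z * Z ω) ∂P = 1 / kummerPhi a b z := fun z h => by
    have hne : kummerPhi a b z ≠ 0 := fun h0 => by
      obtain ⟨k, rfl⟩ := hζ.exists_eq_of_apply_eq_zero hf h0
      have := h k
      rw [div_self (hζ.ne_zero hf0 k)] at this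
      exact lt_irrefl _ this
    have h1 := (integrable_cexp_and_tendsto hm' hlaw' hind' (hsum z) h (hV z)).2
    have h2 := (hζ.hasProd hf hf0 hfb z).tendsto_prod_nat.inv₀
      (mul_ne_zero hne (Complex.exp_ne_zero _))
    simp_rw [hexp]
    rw [integral_const_mul, tendsto_nhds_unique h1 h2, deriv_kummerPhi_zero ha hb, ← hd]
    have := Complex.exp_ne_zero (-(d * z))
    field_simp
  refine ⟨hZm, hconv, hiff, hval, fun B hB hBZ => ?_⟩
  have hBZ' : IndepFun (fun ω => (B ω : ℂ)) Z P :=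
    hBZ.comp Complex.measurable_ofReal measurable_id
  have hBm : AEMeasurable (fun ω => (B ω : ℂ)) P :=
    Complex.measurable_ofReal.comp_aemeasurable hB.aemeasurable
  refine ⟨hBZ', ?_⟩
  -- On a disc free of zeros every |ζ_k| ≥ r, so the transform of Z exists there and the product of
  -- the two transforms is 1.
  obtain ⟨r, hr, hball⟩ : ∃ r > 0, ∀ w : ℂ, ‖w‖ < r → kummerPhi a b w ≠ 0 := by
    have := hf.continuous.continuousAt.eventually_ne (x := 0) (y := 0)
      (by rw [hf0]; exact one_ne_zero)
    obtain ⟨r, hr, h⟩ := Metric.eventually_nhds_iff.1 this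
    exact ⟨r, hr, fun w hw => h (by simpa using hw)⟩
  have hz1 : ∀ z : ℂ, ‖z‖ < r → ∀ k, (z / ζ k).re < 1 := fun z hz k => by
    have h1 : r ≤ ‖ζ k‖ := by
      by_contra h
      exact hball _ (not_le.1 h) (hζ.apply_eq_zero k)
    refine (Complex.re_le_norm _).trans_lt ?_
    rw [norm_div, div_lt_one (hr.trans_le h1)]
    exact hz.trans_le h1
  have hcomp : ∀ z : ℂ, IndepFun (fun ω => Complex.exp (z * (B ω : ℂ)))
      (fun ω => Complex.exp (z * Z ω)) P := fun z =>
    hBZ'.comp (φ := fun w => Complex.exp (z * w)) (ψ := fun w => Complex.exp (z * w))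
      (by fun_prop) (by fun_prop)
  have hBval : ∀ z : ℂ, ∫ ω, Complex.exp (z * (B ω : ℂ)) ∂P = kummerPhi a b z := fun z => by
    rw [kummerPhi_eq_complexMGF ha hb]
    exact hB.integral_comp (f := fun x : ℝ => Complex.exp (z * x)) (by fun_prop)
  have hBint : ∀ z : ℂ, Integrable (fun ω => Complex.exp (z * (B ω : ℂ))) P := fun z => by
    have h := integrable_exp_mul_betaMeasure ha hb z.re
    rw [← hB.map_eq, integrable_map_measure (by fun_prop) hB.aemeasurable] at h
    refine (integrable_norm_iff (Complex.measurable_exp.comp_aemeasurable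
      (hBm.const_mul z)).aestronglyMeasurable).1 (h.congr (ae_of_all _ fun ω => ?_))
    simp [Complex.norm_exp]
  have hadd : ∀ z ω, Complex.exp (z * ((B ω : ℂ) + Z ω)) =
      Complex.exp (z * (B ω : ℂ)) * Complex.exp (z * Z ω) := fun z ω => by
    rw [← Complex.exp_add, mul_add]
  refine integrable_pow_and_integral_eq (hBm.add hZm) hr (fun z hz => ?_) (fun z hz => ?_)
  · simp_rw [hadd]
    exact (hcomp z).integrable_mul (hBint z) ((hiff z).2 (hz1 z hz))
  · simp_rw [hadd]
    have h := (hcomp z).integral_mul_eq_mul_integral (hBint z).1 ((hiff z).2 (hz1 z hz)).1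
    refine h.trans ?_
    rw [hBval, hval z (hz1 z hz), mul_one_div_cancel (hball z hz)]
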